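/- Let $n\ge 1$ and $0\le p\le n$. Let $\Gamma$ be an $n$-dimensional Bieberbach group, i.e. a discrete, cocompact, torsion-free subgroup of the isometry group of $\mathbb R^n$. Write each $\gamma\in\Gamma$ uniquely as $\gamma=BL_b$ with $B\in O(n)$ and $L_b$ the translation by $b\in\mathbb R^n$, so that $\gamma x=B(x+b)$. Let $\Lambda=\{b: L_b\in\Gamma\}$ and let $F=\Lambda\backslash\Gamma$ be the holonomy group. Assume that $\Gamma$ is of diagonal type, i.e. $\Lambda$ has an orthonormal $\mathbb Z$-basis $f_1,\dots,f_n$ with $Bf_i=\pm f_i$ for all $BL_b\in\Gamma$ and all $i$, and that $\Lambda=\mathbb Z^n=\mathbb Z e_1+\dots+\mathbb Z e_n$ is the canonical lattice ($e_1,\dots,e_n$ the standard basis). For $BL_b\in\Gamma$ put $n_B=\dim\ker(B-\mathrm{Id})$ and $n_B(\tfrac12)=|\{i: Be_i=e_i,\ b\cdot e_i\equiv\tfrac12 \bmod \mathbb Z\}|$; both depend only on the class of $BL_b$ in $F$. For $0\le t\le d\le n$ let $c_{d,t}(\Gamma)$ be the number of classes $BL_b\in F$ with $n_B=d$ and $n_B(\tfrac12)=t$.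 Let $$K_p^n(j)=\sum_{t=0}^p(-1)^t\binom jt\binom{n-j}{p-t}.$$ For $\mathrm{Re}(s)>0$ let $Z_p^\Gamma(s)=\sum_{\mu} d_{p,\mu}\,e^{-\mu s}$, where $\mu$ runs over the eigenvalues of the Laplacian on smooth complex $p$-forms on the flat manifold $M_\Gamma=\Gamma\backslash\mathbb R^n$ and $d_{p,\mu}$ is the multiplicity of $\mu$, and let $$x(s)=\frac{1}{\sqrt{4\pi s}}\sum_{m\in\mathbb Z}e^{-m^2/(4s)},\qquad y(s)=\frac{1}{\sqrt{4\pi s}}\sum_{m\in\mathbb Z}e^{-(\frac12+m)^2/(4s)},$$ with the principal square root. Then $F$ is finite, every $d_{p,\mu}$ is finite, the series $Z_p^\Gamma(s)$ converges absolutely for $\mathrm{Re}(s)>0$, and there is a unique polynomial $P\in\mathbb Z[x,y]$ with $$|F|\,Z_p^\Gamma(s)=P(x(s),y(s))\qquad\text{for all } s \text{ with } \mathrm{Re}(s)>0.$$ It has total degree $n$ and no constant term, the coefficient of $x^k$ in $P$ is $0$ for $1\le k\le n-1$, and the coefficient of $x^n$ is $\binom np$. Moreover, for all $0\le t\le d\le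 n$, the coefficient of $x^{d-t}y^t$ in $P$ is $K_p^n(n-d)\,c_{d,t}(\Gamma)$. -/

import Mathlib

/-- Euclidean space of dimension `n`. -/
abbrev EucSp (n : ℕ) : Type := EuclideanSpace ℝ (Fin n)

/-- The isometry group of Euclidean space (every isometry is affine). -/
abbrev EucIsom (n : ℕ) : Type := EucSp n ≃ᵃⁱ[ℝ] EucSp n

namespace Bieb

open scoped ContDiff

variable {n : ℕ}

/-- The homomorphism `B L_b ↦ B` from isometries to orthogonal transformations. -/
noncomputable def linHom (n : ℕ) : EucIsom n →* (EucSp n ≃ₗᵢ[ℝ] EucSp n) where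
  toFun γ := γ.linearIsometryEquiv
  map_one' := by ext x; rfl
  map_mul' _ _ := by ext x; rfl

/-- The vector `b` in the unique decomposition `γ = B L_b`, that is, `γ x = B (x + b)`. -/
noncomputable def transVec (γ : EucIsom n) : EucSp n := (linHom n γ).symm (γ 0)

theorem apply_eq_linHom (γ : EucIsom n) (x : EucSp n) :
    γ x = linHom n γ (x + transVec γ) := by
  have h := γ.map_vadd 0 x
  simp only [vadd_eq_add, add_zero] at h
  simp [transVec, h, linHom]

/-- A Bieberbach group: a discrete, cocompact and torsion-free subgroup of the isometry group. The
isometry group carries the compact-open topology. -/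
structure IsBieberbach (Γ : Subgroup (EucIsom n)) : Prop where
  discrete : DiscreteTopology
    ((fun γ : EucIsom n => (⟨γ, γ.continuous⟩ : C(EucSp n, EucSp n))) '' (Γ : Set (EucIsom n)))
  cocompact : ∃ K : Set (EucSp n), IsCompact K ∧ ∀ x, ∃ γ ∈ Γ, γ x ∈ K
  torsionFree : ∀ γ ∈ Γ, IsOfFinOrder γ → γ = 1

/-- The lattice `Λ` of all `b` such that the translation `L_b` belongs to `Γ`. -/
noncomputable def translationLattice (Γ : Subgroup (EucIsom n)) : AddSubgroup (EucSp n) where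
  carrier := {b | AffineIsometryEquiv.constVAdd ℝ (EucSp n) b ∈ Γ}
  zero_mem' := by
    have h : AffineIsometryEquiv.constVAdd ℝ (EucSp n) (0 : EucSp n) = 1 := by
      ext x; simp
    simp only [Set.mem_ofPred_eq, h, one_mem]
  add_mem' := by
    intro a b ha hb
    have h : AffineIsometryEquiv.constVAdd ℝ (EucSp n) (a + b) =
        AffineIsometryEquiv.constVAdd ℝ (EucSp n) a *
          AffineIsometryEquiv.constVAdd ℝ (EucSp n) b := by
      ext x; simp [add_assoc]
    simp only [Set.mem_ofPred_eq, h] at *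
    exact mul_mem ha hb
  neg_mem' := by
    intro a ha
    have h : AffineIsometryEquiv.constVAdd ℝ (EucSp n) (-a) =
        (AffineIsometryEquiv.constVAdd ℝ (EucSp n) a)⁻¹ := by
      rw [eq_inv_iff_mul_eq_one]; ext x; simp
    simp only [Set.mem_ofPred_eq, h] at *
    exact inv_mem ha

/-- The canonical lattice, `ℤ ε₁ + ⋯ + ℤ εₙ` for the standard basis `ε` of `ℝⁿ`. -/
noncomputable def canonicalLattice (n : ℕ) : AddSubgroup (EucSp n) :=
  AddSubgroup.closure (Set.range (EuclideanSpace.basisFun (Fin n) ℝ))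

/-- Diagonal type: `Λ` has an orthonormal `ℤ`-basis `e` with `B eᵢ = ± eᵢ` for all `B L_b ∈ Γ`
and all `i`. -/
def IsDiagonalType (Γ : Subgroup (EucIsom n)) : Prop :=
  ∃ e : OrthonormalBasis (Fin n) ℝ (EucSp n),
    AddSubgroup.closure (Set.range e) = translationLattice Γ ∧
      ∀ γ ∈ Γ, ∀ i, linHom n γ (e i) = e i ∨ linHom n γ (e i) = -e i

/-- The holonomy group `F`, the quotient of `Γ` by its normal subgroup of translations (the elements
`B L_b` with `B = Id`). -/
abbrev Holonomy (Γ : Subgroup (EucIsom n)) : Type :=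
  Γ ⧸ ((linHom n).comp Γ.subtype).ker

/-- `n_B`, the dimension of the kernel of `B - Id`. -/
noncomputable def fixDim (γ : EucIsom n) : ℕ :=
  Module.finrank ℝ
    (LinearMap.ker ((linHom n γ).toLinearEquiv.toLinearMap - LinearMap.id))

/-- `n_B(1/2)` for `γ = B L_b`, with respect to the canonical basis: the number of `i` such that
`B εᵢ = εᵢ` and `b ⬝ εᵢ ≡ 1/2` modulo `ℤ`. -/
noncomputable def halfCount (γ : EucIsom n) : ℕ :=
  Nat.card {i : Fin n //
    linHom n γ (EuclideanSpace.basisFun (Fin n) ℝ i) = EuclideanSpace.basisFun (Fin n) ℝ i ∧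
      ∃ m : ℤ, inner ℝ (transVec γ) (EuclideanSpace.basisFun (Fin n) ℝ i) = 1 / 2 + (m : ℝ)}

/-- The Sunada number `c_{d,t}(Γ)`: the number of classes of elements `B L_b` of `Γ` modulo
translations with `n_B = d` and `n_B(1/2) = t` (for lattice `ℤⁿ`, neither number depends on the
representative of the class). -/
noncomputable def sunada (Γ : Subgroup (EucIsom n)) (d t : ℕ) : ℕ :=
  Nat.card {q : Holonomy Γ //
    ∃ γ : Γ, (γ : Holonomy Γ) = q ∧ fixDim (γ : EucIsom n) = d ∧ halfCount (γ : EucIsom n) = t}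

/-- The Krawtchouk polynomial `K_p^n` at an integer `x`. -/
def krawtchouk (n p : ℕ) (x : ℤ) : ℤ :=
  ∑ t ∈ Finset.range (p + 1), (-1) ^ t * Ring.choose x t * Ring.choose ((n : ℤ) - x) (p - t)

/-- Complex-valued alternating `p`-forms on the vector space `ℝⁿ`. -/
abbrev Alt (n p : ℕ) : Type := EucSp n [⋀^Fin p]→L[ℝ] ℂ

/-- Pullback `γ^* η` of a differential `p`-form `η` on `ℝⁿ` by an isometry `γ`. -/
noncomputable def pullback {p : ℕ} (γ : EucIsom n) (η : EucSp n → Alt n p) : EucSp n → Alt n p :=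
  fun x => (η (γ x)).compContinuousLinearMap
    ((linHom n γ).toContinuousLinearEquiv : EucSp n →L[ℝ] EucSp n)

/-- The space of smooth complex `p`-forms `η` on `M_Γ = Γ \ ℝⁿ` with `-Δ η = μ η`. Smooth forms on
`M_Γ` are the smooth forms on `ℝⁿ` that are invariant under pullback by `Γ`. As the metric is flat,
the Laplacian (the Hodge Laplacian as well as minus the connection Laplacian) acts on them as
minus the ordinary Laplacian of functions on `ℝⁿ` with values in the vector space of
alternating forms. -/
noncomputable def eigenforms (Γ : Subgroup (EucIsom n)) (p : ℕ) (μ : ℝ) :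
    Submodule ℂ (EucSp n → Alt n p) where
  carrier := {η | ContDiff ℝ ∞ η ∧ (∀ γ ∈ Γ, pullback γ η = η) ∧
    ∀ x, -(Laplacian.laplacian η x) = (μ : ℂ) • η x}
  zero_mem' := by
    refine ⟨contDiff_const, ?_, ?_⟩
    · intro γ _; funext x; ext v; simp [pullback]
    · intro x
      have : (0 : EucSp n → Alt n p) = fun _ => 0 := rfl
      simp [this]
  add_mem' := by
    rintro a b ⟨ha, ia, ea⟩ ⟨hb, ib, eb⟩
    refine ⟨ha.add hb, ?_, ?_⟩
    · intro γ hγ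
      funext x; ext v
      have h1 := congrArg (fun f => f x v) (ia γ hγ)
      have h2 := congrArg (fun f => f x v) (ib γ hγ)
      simp only [pullback] at h1 h2 ⊢
      simp [← h1, ← h2]
    · intro x
      have h := (contDiff_infty.1 ha 2).contDiffAt (x := x)
      have h' := (contDiff_infty.1 hb 2).contDiffAt (x := x)
      rw [h.laplacian_add h', neg_add, ea, eb, Pi.add_apply, smul_add]
  smul_mem' := by
    rintro c a ⟨ha, ia, ea⟩
    let L : Alt n p →L[ℝ] Alt n p := c • ContinuousLinearMap.id ℝ (Alt n p)
    have hL : c • a = L ∘ a := by funext x; rfl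
    refine ⟨?_, ?_, ?_⟩
    · rw [hL]; exact L.contDiff.comp ha
    · intro γ hγ
      funext x; ext v
      have h1 := congrArg (fun f => f x v) (ia γ hγ)
      simp only [pullback] at h1 ⊢
      simp [← h1]
    · intro x
      have h := (contDiff_infty.1 ha 2).contDiffAt (x := x)
      rw [hL, h.laplacian_CLM_comp_left]
      have e := congrArg L (ea x)
      rw [map_neg] at e
      rw [Function.comp_apply, e]
      change c • (μ : ℂ) • a x = (μ : ℂ) • c • a x
      rw [smul_comm]

/-- The multiplicity `d_{p}(μ)` of `μ` as an eigenvalue of the Laplacian on `p`-forms on `M_Γ`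
(zero if `μ` is not an eigenvalue). -/
noncomputable def multiplicity (Γ : Subgroup (EucIsom n)) (p : ℕ) (μ : ℝ) : ℕ :=
  Module.finrank ℂ (eigenforms Γ p μ)

/-- The term of the eigenvalue `μ` in the `p`-heat trace, `μ` counted with multiplicity. -/
noncomputable def heatTerm (Γ : Subgroup (EucIsom n)) (p : ℕ) (s : ℂ) (μ : ℝ) : ℂ :=
  (multiplicity Γ p μ : ℂ) * Complex.exp (-(μ : ℂ) * s)

/-- The `p`-heat trace `Z_p^Γ(s)`, the sum of `exp (-μ s)` over the eigenvalues `μ` of the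
Laplacian on `p`-forms on `M_Γ`, counted with multiplicity. -/
noncomputable def heatTrace (Γ : Subgroup (EucIsom n)) (p : ℕ) (s : ℂ) : ℂ :=
  ∑' μ : ℝ, heatTerm Γ p s μ

/-- `θ₀(s) = ∑_{m ∈ ℤ} exp (-s m²)`. -/
noncomputable def theta0 (s : ℂ) : ℂ := ∑' m : ℤ, Complex.exp (-s * (m : ℂ) ^ 2)

/-- `θ₁(s) = ∑_{m ∈ ℤ} exp (-s (1/2 + m)²)`. -/
noncomputable def theta1 (s : ℂ) : ℂ := ∑' m : ℤ, Complex.exp (-s * (1 / 2 + (m : ℂ)) ^ 2)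

/-- `x(s) = θ₀(1/(4s)) / √(4πs)`, with the principal square root. -/
noncomputable def xFun (s : ℂ) : ℂ :=
  theta0 (1 / (4 * s)) / (4 * (Real.pi : ℂ) * s) ^ (1 / 2 : ℂ)

/-- `y(s) = θ₁(1/(4s)) / √(4πs)`, with the principal square root. -/
noncomputable def yFun (s : ℂ) : ℂ :=
  theta1 (1 / (4 * s)) / (4 * (Real.pi : ℂ) * s) ^ (1 / 2 : ℂ)

/-- `P` represents `|F| Z_p^Γ` as a polynomial in `x` and `y` (variables `0` and `1`) on the right
half plane. -/
def Represents (Γ : Subgroup (EucIsom n)) (p : ℕ) (P : MvPolynomial (Fin 2) ℤ) : Prop :=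
  ∀ s : ℂ, 0 < s.re →
    (Nat.card (Holonomy Γ) : ℂ) * heatTrace Γ p s = MvPolynomial.aeval ![xFun s, yFun s] P

/-- The exponent of the monomial `x^i y^j`. -/
noncomputable def xyExp (i j : ℕ) : Fin 2 →₀ ℕ := Finsupp.single 0 i + Finsupp.single 1 j

end Bieb

/-! Since `Λ = ℤⁿ`, forms on `M_Γ` are the `F`-invariant forms on the torus `ℤⁿ \ ℝⁿ`. Green's
identity kills every Fourier coefficient of a periodic eigenform off the sphere `4π²|u|² = μ`, so
the torus eigenspace has the finite basis `exp(2πi u⬝x) dx_I` (`eigenfunction_eq_sum`, `modeBasis`).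
Each `B L_b` permutes this basis up to scalars (`pullback_mode`). Averaging traces over `F` then
gives `|F| d_{p,μ} = ∑ K_p^n(n - n_B) ∑ exp(2πi u⬝b)`, where `u` runs over the frequencies with
eigenvalue `μ` and `Bu = u` (`card_mul_multiplicity`); the Krawtchouk number is the trace of `B` on
`p`-forms (`sum_prod_sign`).

After weighting by `exp(-μs)` and summing over `μ`, the lattice sum factors over coordinates. A
reversed coordinate contributes 1. In a fixed coordinate `b_i` is an integer or a half-integer,
because `(B L_b)²` is a translation in `Γ`; its factor is a Jacobi theta value, which the functional
equation turns into `x(s)` or `y(s)`. A class thus contributes `K_p^n(n - n_B) x^(n_B - n_B(1/2))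
y^(n_B(1/2))`. The sum of these monomials is `heatPoly`, from which the coefficients are read off.

Pure powers `x^k` with `k < n` are absent by torsion-freeness: if `B ≠ Id`, some fixed coordinate of
`b` is a half-integer (`exists_half`). Only the identity class produces `x^n`.

Uniqueness of `P` is algebraic independence of `x` and `y`: as `s → 0+`, `x` grows like `s^(-1/2)`
while `y` decays exponentially (`eq_zero_of_eventually_aeval_eq_zero`). -/

namespace Bieb

/-! ### Periodic eigenfunctions of the Laplacian and Fourier characters -/

open MeasureTheory InnerProductSpace

variable {n : ℕ}

/-- A function on `ℝⁿ` which is periodic with respect to the standard basis vectors. -/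
def StdPeriodic {F : Type*} (f : EucSp n → F) : Prop :=
  ∀ i x, f (x + EuclideanSpace.single i 1) = f x

section Green

variable {m : ℕ}

/-- The vector field `f ↦ (∂ᵢ f) g - f (∂ᵢ g)` whose divergence is `(Δ f) g - f (Δ g)`. -/
noncomputable def greenField (f g : EucSp n → ℂ) (i : Fin n) (x : EucSp n) : ℂ :=
  fderiv ℝ f x (EuclideanSpace.single i 1) * g x - f x * fderiv ℝ g x (EuclideanSpace.single i 1)

theorem contDiff_greenField {f g : EucSp n → ℂ} (hf : ContDiff ℝ 2 f) (hg : ContDiff ℝ 2 g)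
    (i : Fin n) : ContDiff ℝ 1 (greenField f g i) := by
  have hf' : ContDiff ℝ 1 (fderiv ℝ f) := hf.fderiv_right (by norm_num)
  have hg' : ContDiff ℝ 1 (fderiv ℝ g) := hg.fderiv_right (by norm_num)
  have hf1 : ContDiff ℝ 1 f := hf.of_le (by norm_num)
  have hg1 : ContDiff ℝ 1 g := hg.of_le (by norm_num)
  unfold greenField
  fun_prop

theorem StdPeriodic.fderiv {f : EucSp n → ℂ} (hf : StdPeriodic f) :
    StdPeriodic (fderiv ℝ f) := by
  intro i x
  rw [← fderiv_comp_add_right]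
  congr 1
  funext y
  exact hf i y

theorem stdPeriodic_greenField {f g : EucSp n → ℂ} (hf : StdPeriodic f) (hg : StdPeriodic g)
    (i : Fin n) : StdPeriodic (greenField f g i) := by
  intro j x
  simp only [greenField, hf j x, hg j x, hf.fderiv j x, hg.fderiv j x]

theorem laplacian_eq_sum_fderiv (f : EucSp n → ℂ) (x : EucSp n) :
    Laplacian.laplacian f x = ∑ i, fderiv ℝ (fderiv ℝ f) x (EuclideanSpace.single i 1)
      (EuclideanSpace.single i 1) := by
  have := congrFun (laplacian_eq_iteratedFDeriv_orthonormalBasis f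
    (EuclideanSpace.basisFun (Fin n) ℝ)) x
  simpa [iteratedFDeriv_two_apply] using this

theorem fderiv_greenField {f g : EucSp n → ℂ} (hf : ContDiff ℝ 2 f) (hg : ContDiff ℝ 2 g)
    (i : Fin n) (x : EucSp n) :
    fderiv ℝ (greenField f g i) x (EuclideanSpace.single i 1) =
      fderiv ℝ (fderiv ℝ f) x (EuclideanSpace.single i 1) (EuclideanSpace.single i 1) * g x -
      f x * fderiv ℝ (fderiv ℝ g) x (EuclideanSpace.single i 1) (EuclideanSpace.single i 1) := by
  have hf' : HasFDerivAt (fderiv ℝ f) (fderiv ℝ (fderiv ℝ f) x) x :=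
    ((hf.fderiv_right (m := 1) (by norm_num)).differentiable (by norm_num) x).hasFDerivAt
  have hg' : HasFDerivAt (fderiv ℝ g) (fderiv ℝ (fderiv ℝ g) x) x :=
    ((hg.fderiv_right (m := 1) (by norm_num)).differentiable (by norm_num) x).hasFDerivAt
  have hf1 : HasFDerivAt f (fderiv ℝ f x) x := (hf.differentiable (by norm_num) x).hasFDerivAt
  have hg1 : HasFDerivAt g (fderiv ℝ g x) x := (hg.differentiable (by norm_num) x).hasFDerivAt
  have h := (((hf'.clm_apply (hasFDerivAt_const (EuclideanSpace.single i (1 : ℝ)) x)).mul hg1).sub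
    (hf1.mul (hg'.clm_apply (hasFDerivAt_const (EuclideanSpace.single i (1 : ℝ)) x)))).fderiv
  have h2 : greenField f g i = (((fun y => fderiv ℝ f y (EuclideanSpace.single i 1)) * g) -
      f * fun y => fderiv ℝ g y (EuclideanSpace.single i 1)) := rfl
  rw [h2, h]
  simp
  ring

theorem sum_fderiv_greenField {f g : EucSp n → ℂ} (hf : ContDiff ℝ 2 f) (hg : ContDiff ℝ 2 g)
    (x : EucSp n) :
    ∑ i, fderiv ℝ (greenField f g i) x (EuclideanSpace.single i 1) =
      Laplacian.laplacian f x * g x - f x * Laplacian.laplacian g x := by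
  simp only [fderiv_greenField hf hg, laplacian_eq_sum_fderiv, Finset.sum_sub_distrib,
    Finset.sum_mul, Finset.mul_sum]

/-- Green's identity for periodic functions on the unit cube. -/
theorem integral_green {f g : EucSp (m + 1) → ℂ} (hf : ContDiff ℝ 2 f) (hg : ContDiff ℝ 2 g)
    (pf : StdPeriodic f) (pg : StdPeriodic g) :
    ∫ x in Set.Icc (0 : Fin (m + 1) → ℝ) 1,
      (Laplacian.laplacian f (WithLp.toLp 2 x) * g (WithLp.toLp 2 x) -
        f (WithLp.toLp 2 x) * Laplacian.laplacian g (WithLp.toLp 2 x)) = 0 := by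
  set L : (Fin (m + 1) → ℝ) →L[ℝ] EucSp (m + 1) :=
    ((EuclideanSpace.equiv (Fin (m + 1)) ℝ).symm : (Fin (m + 1) → ℝ) →L[ℝ] EucSp (m + 1))
  have hL : ∀ x, L x = WithLp.toLp 2 x := fun x => rfl
  have hLs : ∀ i, L (Pi.single i 1) = EuclideanSpace.single i 1 := fun i => rfl
  have hc := fun i => contDiff_greenField hf hg i
  have hd : ∀ i x, HasFDerivAt (fun y => greenField f g i (L y))
      ((fderiv ℝ (greenField f g i) (L x)).comp L) x := fun i x =>
    (((hc i).differentiable (by norm_num) (L x)).hasFDerivAt).comp x L.hasFDerivAt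
  have key := integral_divergence_of_hasFDerivAt_off_countable' (E := ℂ) (n := m) 0 1
    (by intro i; simp) (fun i x => greenField f g i (L x))
    (fun i x => (fderiv ℝ (greenField f g i) (L x)).comp L) ∅ Set.countable_empty
    (fun i => ((hc i).continuous.comp L.continuous).continuousOn)
    (fun x _ i => hd i x)
    (by
      apply ContinuousOn.integrableOn_compact isCompact_Icc
      apply Continuous.continuousOn
      have hcc : ∀ i, Continuous (fderiv ℝ (greenField f g i)) := fun i =>
        (hc i).continuous_fderiv (by norm_num)
      refine continuous_finsetSum _ fun i _ => ?_
      exact ((hcc i).comp L.continuous).clm_apply continuous_const)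
  simp only [ContinuousLinearMap.comp_apply, hLs, sum_fderiv_greenField hf hg] at key
  simp only [hL] at key
  rw [key]
  -- The boundary term is a sum over pairs of opposite faces of the cube. These differ by a standard
  -- basis vector, so the fluxes cancel by periodicity.
  refine Finset.sum_eq_zero fun i _ => ?_
  rw [sub_eq_zero]
  congr 1
  funext x
  have : (WithLp.toLp 2 (Fin.insertNth (α := fun _ => ℝ) i 1 x) : EucSp (m + 1)) =
      WithLp.toLp 2 (Fin.insertNth (α := fun _ => ℝ) i 0 x) + EuclideanSpace.single i 1 := by
    ext k
    rcases Fin.eq_self_or_eq_succAbove i k with rfl | ⟨j, rfl⟩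
    · simp
    · simp
  have h3 := stdPeriodic_greenField pf pg i i (WithLp.toLp 2 (Fin.insertNth (α := fun _ => ℝ) i 0 x))
  rw [← this] at h3
  exact h3

end Green

/-- The character `x ↦ exp (2 π i u ⬝ x)` of `ℝⁿ`. -/
noncomputable def expChar (u : Fin n → ℤ) (x : EucSp n) : ℂ :=
  Complex.exp (2 * Real.pi * Complex.I * ∑ k, (u k : ℂ) * (x k : ℂ))

theorem expChar_add (u : Fin n → ℤ) (x y : EucSp n) :
    expChar u (x + y) = expChar u x * expChar u y := by
  simp only [expChar, ← Complex.exp_add, PiLp.add_apply, Complex.ofReal_add, mul_add,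
    Finset.sum_add_distrib]

theorem expChar_of_int (u : Fin n → ℤ) (x : EucSp n) (h : ∀ i, ∃ m : ℤ, x i = m) :
    expChar u x = 1 := by
  choose m hm using h
  rw [expChar, Complex.exp_eq_one_iff]
  refine ⟨∑ k, u k * m k, ?_⟩
  simp only [hm]
  push_cast
  ring

theorem stdPeriodic_expChar (u : Fin n → ℤ) : StdPeriodic (expChar u) := by
  intro i x
  rw [expChar_add, expChar_of_int u (EuclideanSpace.single i 1), mul_one]
  intro j
  by_cases h : j = i
  · exact ⟨1, by simp [h]⟩
  · exact ⟨0, by simp [h]⟩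

theorem contDiff_expChar (u : Fin n → ℤ) {k : WithTop ℕ∞} : ContDiff ℝ k (expChar u) := by
  unfold expChar
  refine ContDiff.cexp (contDiff_const.mul (ContDiff.sum fun i _ => contDiff_const.mul ?_))
  exact Complex.ofRealCLM.contDiff.comp (EuclideanSpace.proj i : EucSp n →L[ℝ] ℝ).contDiff

theorem fderiv_expChar (u : Fin n → ℤ) (i : Fin n) (x : EucSp n) :
    fderiv ℝ (expChar u) x (EuclideanSpace.single i 1) =
      (2 * Real.pi * Complex.I * u i) * expChar u x := by
  have h1 : ∀ k : Fin n, HasFDerivAt (fun y : EucSp n => (u k : ℂ) * ((y k : ℝ) : ℂ))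
      ((u k : ℂ) • (Complex.ofRealCLM.comp (EuclideanSpace.proj k : EucSp n →L[ℝ] ℝ))) x :=
    fun k => ((Complex.ofRealCLM.comp
      (EuclideanSpace.proj k : EucSp n →L[ℝ] ℝ)).hasFDerivAt).const_mul _
  have h2 := ((HasFDerivAt.fun_sum fun k (_ : k ∈ Finset.univ) => h1 k).const_mul
    (2 * Real.pi * Complex.I)).cexp.fderiv
  have : expChar u = fun y => Complex.exp (2 * Real.pi * Complex.I *
    ∑ k, (u k : ℂ) * (y k : ℂ)) := rfl
  rw [this, h2]
  simp [apply_ite]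
  ring

/-- The eigenvalue `4 π² |u|²` of the character `expChar u`. -/
noncomputable def eigVal (u : Fin n → ℤ) : ℝ := 4 * Real.pi ^ 2 * ∑ i, (u i : ℝ) ^ 2

theorem laplacian_expChar (u : Fin n → ℤ) (x : EucSp n) :
    Laplacian.laplacian (expChar u) x = -(eigVal u : ℂ) * expChar u x := by
  rw [laplacian_eq_sum_fderiv]
  have h : ∀ i, fderiv ℝ (fderiv ℝ (expChar u)) x (EuclideanSpace.single i 1)
      (EuclideanSpace.single i 1) = (2 * Real.pi * Complex.I * u i) ^ 2 * expChar u x := by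
    intro i
    have hd : DifferentiableAt ℝ (fderiv ℝ (expChar u)) x :=
      ((contDiff_expChar u (k := 2)).fderiv_right (m := 1) (by norm_num)).differentiable
        (by norm_num) x
    have h1 : (fderiv ℝ (fun y => fderiv ℝ (expChar u) y (EuclideanSpace.single i 1)) x)
        (EuclideanSpace.single i 1) = fderiv ℝ (fderiv ℝ (expChar u)) x (EuclideanSpace.single i 1)
      (EuclideanSpace.single i 1) := by
      rw [fderiv_clm_apply hd (differentiableAt_const _)]
      simp
    rw [← h1]
    have h2 : (fun y => fderiv ℝ (expChar u) y (EuclideanSpace.single i 1)) =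
      fun y => (2 * Real.pi * Complex.I * u i) * expChar u y := funext fun y => fderiv_expChar u i y
    rw [h2, fderiv_const_mul ((contDiff_expChar u (k := 1)).differentiable (by norm_num) x)]
    simp only [smul_apply, fderiv_expChar, smul_eq_mul]
    ring
  simp only [h, eigVal, mul_pow, Complex.I_sq]
  push_cast
  rw [← Finset.sum_mul, ← Finset.mul_sum]
  ring

theorem StdPeriodic.add_int_smul {F : Type*} {f : EucSp n → F} (hf : StdPeriodic f) (i : Fin n)
    (m : ℤ) (x : EucSp n) : f (x + EuclideanSpace.single i (m : ℝ)) = f x := by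
  induction m using Int.induction_on generalizing x with
  | zero =>
    have : (EuclideanSpace.single i ((0 : ℤ) : ℝ) : EucSp n) = 0 := by
      ext j; by_cases h : j = i <;> simp [h]
    rw [this, add_zero]
  | succ k ih =>
    have : (EuclideanSpace.single i (((k : ℤ) + 1 : ℤ) : ℝ) : EucSp n) =
      EuclideanSpace.single i ((k : ℤ) : ℝ) + EuclideanSpace.single i 1 := by
      ext j; by_cases h : j = i <;> simp [h]
    rw [this, ← add_assoc, hf, ih]
  | pred k ih =>
    have : (EuclideanSpace.single i ((-(k : ℤ) - 1 : ℤ) : ℝ) : EucSp n) + EuclideanSpace.single i 1 =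
      EuclideanSpace.single i ((-(k : ℤ) : ℤ) : ℝ) := by
      ext j; by_cases h : j = i <;> simp [h]
    rw [← hf i, add_assoc, this, ih]

theorem StdPeriodic.add_int {F : Type*} {f : EucSp n → F} (hf : StdPeriodic f) (x y : EucSp n)
    (hy : ∀ i, ∃ m : ℤ, y i = m) : f (x + y) = f x := by
  choose m hm using hy
  have hsum : y = ∑ i, EuclideanSpace.single i (m i : ℝ) := by
    ext j
    simp [hm]
  rw [hsum]
  induction (Finset.univ : Finset (Fin n)) using Finset.induction_on generalizing x with
  | empty => simp
  | insert i s his ih => rw [Finset.sum_insert his, ← add_assoc, ih, hf.add_int_smul]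

/-- A continuous periodic function on `ℝⁿ` descends to the torus. -/
theorem StdPeriodic.exists_torus {f : EucSp n → ℂ} (hf : StdPeriodic f) (hc : Continuous f) :
    ∃ F : C(UnitAddTorus (Fin n), ℂ), ∀ x : Fin n → ℝ,
      F (fun i => (x i : UnitAddCircle)) = f (WithLp.toLp 2 x) := by
  have hq : IsOpenQuotientMap (Pi.map fun (_ : Fin n) (t : ℝ) => (t : UnitAddCircle)) :=
    IsOpenQuotientMap.piMap fun _ => QuotientAddGroup.isOpenQuotientMap_mk
  let g : C(Fin n → ℝ, ℂ) := ⟨fun x => f (WithLp.toLp 2 x), by fun_prop⟩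
  have hg : ∀ x y : Fin n → ℝ, Pi.map (fun (_ : Fin n) (t : ℝ) => (t : UnitAddCircle)) x =
      Pi.map (fun (_ : Fin n) (t : ℝ) => (t : UnitAddCircle)) y → g x = g y := by
    intro x y hxy
    have : (WithLp.toLp 2 x : EucSp n) = WithLp.toLp 2 y + WithLp.toLp 2 (x - y) := by
      ext i; simp
    change f _ = f _
    rw [this, hf.add_int]
    intro i
    have h1 := congrFun hxy i
    simp only [Pi.map_apply] at h1
    rw [← sub_eq_zero, ← AddCircle.coe_sub, AddCircle.coe_eq_zero_iff] at h1
    obtain ⟨k, hk⟩ := h1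
    exact ⟨k, by simpa using hk.symm⟩
  let π : C(Fin n → ℝ, UnitAddTorus (Fin n)) := ⟨_, hq.continuous⟩
  have hπ : Topology.IsQuotientMap π := hq.isQuotientMap
  refine ⟨hπ.lift g fun x y => hg x y, fun x => ?_⟩
  exact congrArg (fun h : C(Fin n → ℝ, ℂ) => h x) (hπ.lift_comp g fun x y => hg x y)

theorem mFourier_coe (u : Fin n → ℤ) (x : Fin n → ℝ) :
    UnitAddTorus.mFourier u (fun i => (x i : UnitAddCircle)) = expChar u (WithLp.toLp 2 x) := by
  simp only [UnitAddTorus.mFourier, ContinuousMap.coe_mk, fourier_coe_apply, expChar,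
    ← Complex.exp_sum, Finset.mul_sum]
  congr 1
  refine Finset.sum_congr rfl fun i _ => ?_
  simp
  ring

theorem finite_eigVal (μ : ℝ) : {u : Fin n → ℤ | eigVal u = μ}.Finite := by
  -- A crude bound suffices: `4π² ≥ 1` gives `u_i² ≤ μ`, and `|k| ≤ k²` for integers.
  have hpi : 1 ≤ 4 * Real.pi ^ 2 := by nlinarith [Real.pi_gt_three]
  refine (Set.Finite.pi' (t := fun _ : Fin n => {k : ℤ | |k| ≤ ⌈μ⌉})
    (fun _ => ?_)).subset ?_
  · refine (Set.finite_Icc (-⌈μ⌉) ⌈μ⌉).subset fun k hk => ?_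
    exact abs_le.1 hk
  · intro u hu i
    have h1 : (u i : ℝ) ^ 2 ≤ ∑ i, (u i : ℝ) ^ 2 :=
      Finset.single_le_sum (f := fun i => (u i : ℝ) ^ 2) (fun _ _ => sq_nonneg _)
        (Finset.mem_univ i)
    have h2 : (u i : ℝ) ^ 2 ≤ μ := by
      have hu' : 4 * Real.pi ^ 2 * ∑ i, (u i : ℝ) ^ 2 = μ := hu
      nlinarith [sq_nonneg (u i : ℝ)]
    have h3 : (u i) ^ 2 ≤ ⌈μ⌉ := by
      have := h2.trans (Int.le_ceil μ)
      exact_mod_cast this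
    have h4 : |u i| ≤ (u i) ^ 2 := by
      rw [← sq_abs]
      rcases eq_or_lt_of_le (abs_nonneg (u i)) with h | h
      · rw [← h]; norm_num
      · nlinarith
    exact h4.trans h3

/-- A periodic eigenfunction of the Laplacian is a finite linear combination of characters. -/
theorem eigenfunction_eq_sum (hn : 1 ≤ n) {f : EucSp n → ℂ} (hf : ContDiff ℝ 2 f)
    (pf : StdPeriodic f) (μ : ℝ) (hμ : ∀ x, -(Laplacian.laplacian f x) = (μ : ℂ) • f x) :
    ∃ c : (Fin n → ℤ) → ℂ, f = ∑ u ∈ (finite_eigVal μ).toFinset, c u • expChar u := by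
  obtain ⟨m, rfl⟩ : ∃ m, n = m + 1 := ⟨n - 1, by omega⟩
  obtain ⟨F, hF⟩ := pf.exists_torus hf.continuous
  have hcoef : ∀ u, eigVal u ≠ μ → UnitAddTorus.mFourierCoeff F u = 0 := by
    intro u hu
    -- Pairing with the conjugate character turns Green's identity into `(eigVal u - μ)` times the
    -- `u`-th Fourier coefficient equals zero.
    have h1 := integral_green hf (contDiff_expChar (-u)) pf (stdPeriodic_expChar (-u))
    have h2 : ∀ x : EucSp (m + 1), Laplacian.laplacian f x * expChar (-u) x -
        f x * Laplacian.laplacian (expChar (-u)) x =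
        ((eigVal u : ℂ) - μ) * (expChar (-u) x * f x) := by
      intro x
      have h3 : Laplacian.laplacian f x = -((μ : ℂ) * f x) := by
        rw [← smul_eq_mul, ← hμ x, neg_neg]
      have h4 : eigVal (-u) = eigVal u := by simp [eigVal]
      rw [h3, laplacian_expChar, h4]
      ring
    simp only [h2] at h1
    rw [integral_const_mul, mul_eq_zero] at h1
    have h5 : ((eigVal u : ℂ) - μ) ≠ 0 := by
      rw [sub_ne_zero]
      exact_mod_cast hu
    have h6 := h1.resolve_left h5
    rw [UnitAddTorus.mFourierCoeff_eq_integral F u 0]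
    -- The Fourier coefficient is an integral over a half-open cube, Green's identity over the
    -- closed one; they differ by a null set.
    have hset : {x : Fin (m + 1) → ℝ | ∀ i, x i ∈ Set.Ioc ((0 : Fin (m + 1) → ℝ) i)
        ((0 : Fin (m + 1) → ℝ) i + 1)} =ᵐ[volume] Set.Icc (0 : Fin (m + 1) → ℝ) 1 := by
      have := Measure.univ_pi_Ioc_ae_eq_Icc (μ := fun _ : Fin (m + 1) => (volume : Measure ℝ))
        (f := 0) (g := 1)
      have hs : {x : Fin (m + 1) → ℝ | ∀ i, x i ∈ Set.Ioc ((0 : Fin (m + 1) → ℝ) i)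
          ((0 : Fin (m + 1) → ℝ) i + 1)} = Set.univ.pi fun i => Set.Ioc
            ((0 : Fin (m + 1) → ℝ) i) ((1 : Fin (m + 1) → ℝ) i) := by
        ext x
        simp
      rw [hs]
      exact this
    rw [setIntegral_congr_set hset]
    simpa only [mFourier_coe, hF, smul_eq_mul] using h6
  have hsupp : ∀ u ∉ (finite_eigVal (n := m + 1) μ).toFinset,
      UnitAddTorus.mFourierCoeff F u = 0 := by
    intro u hu
    exact hcoef u (by simpa using hu)
  refine ⟨UnitAddTorus.mFourierCoeff F, funext fun x => ?_⟩
  -- With finitely many nonzero coefficients the Fourier series is summable, hence converges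
  -- pointwise to the function.
  have hs := UnitAddTorus.hasSum_mFourier_series_apply_of_summable
    (summable_of_ne_finset_zero hsupp) (fun i => (x i : UnitAddCircle))
  have hs2 := hs.unique (hasSum_sum_of_ne_finset_zero (s := (finite_eigVal μ).toFinset)
    fun u hu => by rw [hsupp u hu, zero_smul])
  rw [hF] at hs2
  simpa [mFourier_coe] using hs2

/-- The characters `expChar u` are linearly independent. -/
theorem linearIndependent_expChar :
    LinearIndependent ℂ (fun u : Fin n → ℤ => (expChar u : EucSp n → ℂ)) := by
  -- Dedekind's independence of characters applies once distinct `u` give distinct homomorphisms;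
  -- the gradient at 0 recovers `u`.
  let ψ : (Fin n → ℤ) → (Multiplicative (EucSp n) →* ℂ) := fun u =>
    { toFun := fun x => expChar u x.toAdd
      map_one' := by simp [expChar]
      map_mul' := fun x y => by simp [expChar_add] }
  have hψ : Function.Injective ψ := by
    intro u v huv
    funext i
    have h : expChar u = expChar v := by
      funext x
      exact congrArg (fun φ : Multiplicative (EucSp n) →* ℂ => φ (Multiplicative.ofAdd x)) huv
    have h1 := fderiv_expChar u i 0
    rw [h, fderiv_expChar v i 0] at h1
    simpa [expChar, Real.pi_ne_zero] using h1.symm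
  exact (linearIndependent_monoidHom (Multiplicative (EucSp n)) ℂ).comp ψ hψ

end Bieb

/-! ### Alternating forms and Krawtchouk numbers -/

namespace Bieb

variable {n p : ℕ}

/-- The index set of the standard basis of the space of alternating `p`-forms. -/
abbrev FormIdx (n p : ℕ) : Type := Set.powersetCard (Fin n) p

/-- The increasing enumeration of a `p`-subset of `Fin n`. -/
noncomputable def FormIdx.enum (I : FormIdx n p) : Fin p ↪o Fin n :=
  Set.powersetCard.ofFinEmbEquiv.symm I

/-- The alternating form `dx_{i₁} ∧ ⋯ ∧ dx_{i_p}`. -/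
noncomputable def stdForm (I : FormIdx n p) : Alt n p :=
  { Complex.ofRealCLM.toLinearMap.compAlternatingMap
      ((Matrix.detRowAlternating (R := ℝ) (n := Fin p)).compLinearMap
        (LinearMap.pi fun j => ((EuclideanSpace.proj (I.enum j) : EucSp n →L[ℝ] ℝ) :
          EucSp n →ₗ[ℝ] ℝ))) with
    cont := by
      change Continuous fun v : Fin p → EucSp n =>
        (((Matrix.of fun i j => v i (I.enum j)).det : ℝ) : ℂ)
      apply Complex.continuous_ofReal.comp
      apply Continuous.matrix_det
      fun_prop }

theorem stdForm_apply (I : FormIdx n p) (v : Fin p → EucSp n) :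
    stdForm I v = ((Matrix.of fun i j => v i (I.enum j)).det : ℝ) := rfl

/-- The standard basis vectors indexed by a `p`-subset. -/
noncomputable def stdVec (I : FormIdx n p) (k : Fin p) : EucSp n :=
  EuclideanSpace.single (I.enum k) 1

-- Distinct index sets of the same size leave some element of `I` outside `J`, and that element
-- gives a zero column in the determinant.
open Classical in
theorem stdForm_stdVec (I J : FormIdx n p) :
    stdForm I (stdVec J) = if I = J then 1 else 0 := by
  rw [stdForm_apply]
  split_ifs with h
  · subst h
    have : (Matrix.of fun i j => stdVec I i (I.enum j)) = (1 : Matrix (Fin p) (Fin p) ℝ) := by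
      ext i j
      simp [stdVec, Matrix.one_apply, eq_comm]
    rw [this]; simp
  · obtain ⟨i, hi, hj⟩ := (Set.powersetCard.exists_mem_notMem_iff_ne I J).mp h
    obtain ⟨k, rfl⟩ := (Set.powersetCard.mem_range_ofFinEmbEquiv_symm_iff_mem I i).mpr hi
    rw [Matrix.det_eq_zero_of_column_eq_zero k]
    · simp
    · intro j
      have : I.enum k ≠ J.enum j := by
        intro e
        apply hj
        rw [← Set.powersetCard.mem_range_ofFinEmbEquiv_symm_iff_mem]
        exact ⟨j, e.symm⟩
      simp [stdVec, this]

/-- An alternating map is determined by its values on injective tuples of basis vectors. Sorting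
such a tuple makes it increasing and changes both values by the same sign. -/
theorem Alt.ext_stdVec {f g : Alt n p} (h : ∀ I : FormIdx n p, f (stdVec I) = g (stdVec I)) :
    f = g := by
  apply ContinuousAlternatingMap.toAlternatingMap_injective
  refine Module.Basis.ext_alternating (EuclideanSpace.basisFun (Fin n) ℝ).toBasis fun v hv => ?_
  have hmono : StrictMono (v ∘ Tuple.sort v) :=
    (Tuple.monotone_sort v).strictMono_of_injective (hv.comp (Tuple.sort v).injective)
  let e : Fin p ↪o Fin n := OrderEmbedding.ofStrictMono _ hmono
  let I : FormIdx n p := Set.powersetCard.ofFinEmbEquiv e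
  have hI : I.enum = e := Set.powersetCard.ofFinEmbEquiv.symm_apply_apply e
  have h1 := h I
  have h2 : stdVec I = (fun i => (EuclideanSpace.basisFun (Fin n) ℝ).toBasis (v i)) ∘
      Tuple.sort v := by
    funext k
    simp [stdVec, hI, e]
  rw [h2] at h1
  have hf := f.toAlternatingMap.map_perm
    (fun i => (EuclideanSpace.basisFun (Fin n) ℝ).toBasis (v i)) (Tuple.sort v)
  have hg := g.toAlternatingMap.map_perm
    (fun i => (EuclideanSpace.basisFun (Fin n) ℝ).toBasis (v i)) (Tuple.sort v)
  have h3 := hf.symm.trans (Eq.trans h1 hg)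
  exact MulAction.injective _ h3

theorem Alt.eq_sum_stdForm (f : Alt n p) : f = ∑ I : FormIdx n p, f (stdVec I) • stdForm I := by
  classical
  refine Alt.ext_stdVec fun J => ?_
  simp [stdForm_stdVec, ContinuousAlternatingMap.sum_apply]

/-- The pullback of a standard form under a diagonal map. -/
theorem stdForm_compContinuousLinearMap (I : FormIdx n p) (L : EucSp n →L[ℝ] EucSp n)
    (σ : Fin n → ℤ) (hL : ∀ x i, L x i = σ i * x i) :
    (stdForm I).compContinuousLinearMap L =
      ((∏ i ∈ (I : Finset (Fin n)), σ i : ℤ) : ℂ) • stdForm I := by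
  ext v
  have h : (stdForm I).compContinuousLinearMap L v = stdForm I (L ∘ v) := rfl
  rw [h, ContinuousAlternatingMap.smul_apply, stdForm_apply, stdForm_apply]
  simp only [Function.comp_apply, hL]
  have h1 := Matrix.det_mul_row (fun j : Fin p => (σ (I.enum j) : ℝ))
    (Matrix.of fun i j => v i (I.enum j))
  simp only [Matrix.of_apply] at h1
  rw [h1]
  have h2 : ∏ i ∈ (I : Finset (Fin n)), σ i = ∏ j, σ (I.enum j) := by
    have h3 : (I : Finset (Fin n)) = Finset.univ.map I.enum.toEmbedding :=
      (Finset.map_orderEmbOfFin_univ I.1 I.2).symm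
    rw [h3, Finset.prod_map]
    rfl
  rw [h2]
  push_cast
  rw [smul_eq_mul]

open Polynomial in
/-- The elementary symmetric function of a family of signs is a Krawtchouk number. -/
theorem sum_prod_sign (σ : Fin n → ℤ) (hσ : ∀ i, σ i = 1 ∨ σ i = -1) :
    ∑ I : FormIdx n p, ∏ i ∈ (I : Finset (Fin n)), σ i =
      krawtchouk n p ((n : ℤ) - (Finset.univ.filter fun i => σ i = 1).card) := by
  set d := (Finset.univ.filter fun i => σ i = 1).card with hd
  have hdn : d ≤ n := by simpa using Finset.card_filter_le Finset.univ (fun i => σ i = 1)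
  have hd' : (Finset.univ.filter fun i => ¬ σ i = 1).card = n - d := by
    have := Finset.card_filter_add_card_filter_not (s := (Finset.univ : Finset (Fin n)))
      (fun i => σ i = 1)
    simp at this
    omega
  -- Generating function: the elementary symmetric function is the coefficient of `X^p` in `∏ (1 +
  -- σ_i X) = (1 - X)^(n-d) (1 + X)^d`.
  have h1 : ∏ i, (1 + C (σ i) * X) = ((1 + X) ^ (n - d)).comp (C (-1) * X) * (1 + X : ℤ[X]) ^ d := by
    rw [← Finset.prod_filter_mul_prod_filter_not Finset.univ (fun i => σ i = 1), mul_comm]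
    congr 1
    · rw [Finset.prod_congr rfl (g := fun _ => (1 + C (-1) * X : ℤ[X])), Finset.prod_const, hd']
      · simp
      · intro i hi
        rw [(hσ i).resolve_left (Finset.mem_filter.1 hi).2]
    · rw [Finset.prod_congr rfl (g := fun _ => (1 + X : ℤ[X])), Finset.prod_const]
      intro i hi
      rw [(Finset.mem_filter.1 hi).2]
      simp
  have h2 := congrArg (fun q => coeff q p) h1
  simp only [Finset.prod_one_add, finsetSum_coeff, Finset.prod_mul_distrib, Finset.prod_const,
    ← map_prod, coeff_C_mul, coeff_X_pow] at h2
  simp only [coeff_mul, comp_C_mul_X_coeff, coeff_one_add_X_pow] at h2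
  rw [Finset.Nat.sum_antidiagonal_eq_sum_range_succ_mk] at h2
  have h3 : krawtchouk n p ((n : ℤ) - d) = ∑ k ∈ Finset.range p.succ,
      ((n - d).choose k : ℤ) * (-1) ^ k * (d.choose (p - k) : ℤ) := by
    unfold krawtchouk
    refine Finset.sum_congr rfl fun t _ => ?_
    rw [sub_sub_cancel, ← Nat.cast_sub hdn, Ring.choose_natCast, Ring.choose_natCast]
    ring
  rw [h3, ← h2, ← Finset.sum_subset (Finset.powersetCard_eq_filter ▸ Finset.filter_subset _ _ :
    Finset.powersetCard p Finset.univ ⊆ (Finset.univ : Finset (Fin n)).powerset)]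
  · rw [Finset.sum_subtype (p := fun s => s ∈ Set.powersetCard (Fin n) p)
      (Finset.powersetCard p (Finset.univ : Finset (Fin n)))]
    · refine Finset.sum_congr rfl fun I _ => ?_
      have : (I : Finset (Fin n)).card = p := I.2
      simp [this]
    · intro s
      simp [Finset.mem_powersetCard]
  · intro s _ hs
    rw [if_neg, mul_zero]
    intro h
    exact hs (by simp [Finset.mem_powersetCard, h])

end Bieb

/-! ### Diagonal groups with lattice `ℤⁿ`: signs, half-integers, torsion -/

namespace Bieb

variable {n : ℕ}

/-- The translation `L_b` as an isometry. -/
noncomputable abbrev trans (b : EucSp n) : EucIsom n := AffineIsometryEquiv.constVAdd ℝ (EucSp n) b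

/-- Groups of isometries whose rotational parts are diagonal with entries `±1` and whose
translations are the integral ones. -/
structure IsDiagInt (Γ : Subgroup (EucIsom n)) : Prop where
  sign : ∀ γ ∈ Γ, ∀ i, linHom n γ (EuclideanSpace.single i 1) = EuclideanSpace.single i 1 ∨
    linHom n γ (EuclideanSpace.single i 1) = -EuclideanSpace.single i 1
  lattice : ∀ b, trans b ∈ Γ ↔ ∀ i, ∃ m : ℤ, b i = m

theorem mem_canonicalLattice (b : EucSp n) :
    b ∈ canonicalLattice n ↔ ∀ i, ∃ m : ℤ, b i = m := by
  constructor
  · intro hb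
    refine AddSubgroup.closure_induction (p := fun (x : EucSp n) _ => ∀ i, ∃ m : ℤ, x i = (m : ℝ)) ?_ ?_ ?_ ?_ hb
    · rintro _ ⟨j, rfl⟩ i
      by_cases h : i = j
      · exact ⟨1, by simp [h]⟩
      · exact ⟨0, by simp [h]⟩
    · exact fun i => ⟨0, by simp⟩
    · intro x y _ _ hx hy i
      obtain ⟨k, hk⟩ := hx i
      obtain ⟨l, hl⟩ := hy i
      exact ⟨k + l, by simp [hk, hl]⟩
    · intro x _ hx i
      obtain ⟨k, hk⟩ := hx i
      exact ⟨-k, by simp [hk]⟩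
  · intro h
    choose m hm using h
    have hsum : b = ∑ i, m i • EuclideanSpace.basisFun (Fin n) ℝ i := by
      ext j
      simp [hm, Pi.single_apply]
    rw [hsum]
    exact sum_mem fun i _ => zsmul_mem (AddSubgroup.subset_closure (Set.mem_range_self i)) _

/-- An integral vector of norm one is a standard basis vector up to sign. -/
theorem eq_single_or_neg_of_int {v : EucSp n} (hv : ∀ i, ∃ m : ℤ, v i = m) (h1 : ‖v‖ = 1) :
    ∃ i, v = EuclideanSpace.single i 1 ∨ v = -EuclideanSpace.single i 1 := by
  choose m hm using hv
  have h2 : ∑ i, (m i) ^ 2 = 1 := by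
    have h := EuclideanSpace.norm_sq_eq v
    rw [h1] at h
    simp only [hm, Real.norm_eq_abs, sq_abs] at h
    have : ((1 : ℤ) : ℝ) = ((∑ i, (m i) ^ 2 : ℤ) : ℝ) := by push_cast; linarith
    exact_mod_cast this.symm
  obtain ⟨i, hi⟩ : ∃ i, m i ≠ 0 := by
    by_contra! h
    simp [h] at h2
  rw [← Finset.add_sum_erase _ _ (Finset.mem_univ i)] at h2
  have hpos : 0 ≤ ∑ j ∈ Finset.univ.erase i, (m j) ^ 2 := Finset.sum_nonneg fun _ _ => sq_nonneg _
  have hi2 : 1 ≤ (m i) ^ 2 := by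
    have := sq_pos_of_ne_zero hi
    omega
  have hzero : ∑ j ∈ Finset.univ.erase i, (m j) ^ 2 = 0 := by omega
  have hi3 : (m i) ^ 2 = 1 := by omega
  have hj : ∀ j, j ≠ i → m j = 0 := by
    intro j hji
    have := (Finset.sum_eq_zero_iff_of_nonneg fun _ _ => sq_nonneg _).1 hzero j (by simp [hji])
    exact pow_eq_zero_iff (two_ne_zero) |>.1 this
  refine ⟨i, ?_⟩
  rcases (sq_eq_one_iff.1 hi3) with h | h
  · left
    ext j
    by_cases hji : j = i
    · subst hji; simp [hm, h]
    · simp [hm, hj j hji, hji]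
  · right
    ext j
    by_cases hji : j = i
    · subst hji; simp [hm, h]
    · simp [hm, hj j hji, hji]

/-- The given orthonormal basis lies in `ℤⁿ` and consists of unit vectors, so it is the standard
basis up to order and signs; diagonality therefore holds in the standard basis. -/
theorem IsDiagonalType.isDiagInt {Γ : Subgroup (EucIsom n)} (hdiag : IsDiagonalType Γ)
    (hcan : translationLattice Γ = canonicalLattice n) : IsDiagInt Γ := by
  obtain ⟨e, he, hsign⟩ := hdiag
  have hint : ∀ j, ∃ i, e j = EuclideanSpace.single i 1 ∨ e j = -EuclideanSpace.single i 1 := by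
    intro j
    apply eq_single_or_neg_of_int
    · rw [← mem_canonicalLattice, ← hcan, ← he]
      exact AddSubgroup.subset_closure ⟨j, rfl⟩
    · exact e.orthonormal.1 j
  choose π hπ using hint
  have hinj : Function.Injective π := by
    intro j k hjk
    by_contra hne
    have h0 := e.orthonormal.2 hne
    rcases hπ j with h1 | h1 <;> rcases hπ k with h2 | h2 <;>
      simp [h1, h2, hjk] at h0
  have hsurj : Function.Surjective π := Finite.injective_iff_surjective.1 hinj
  refine ⟨fun γ hγ i => ?_, fun b => ?_⟩
  · obtain ⟨j, rfl⟩ := hsurj i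
    have := hsign γ hγ j
    rcases hπ j with h1 | h1
    · rwa [h1] at this
    · rw [h1, map_neg, neg_inj, neg_inj] at this
      exact this
  · rw [← mem_canonicalLattice, ← hcan]
    rfl

open Classical in
/-- The sign `±1` of `B` in the direction of the `i`-th standard basis vector. -/
noncomputable def sgn (γ : EucIsom n) (i : Fin n) : ℤ :=
  if linHom n γ (EuclideanSpace.single i 1) = EuclideanSpace.single i 1 then 1 else -1

theorem sgn_eq (γ : EucIsom n) (i : Fin n) : sgn γ i = 1 ∨ sgn γ i = -1 := by
  unfold sgn
  split_ifs <;> simp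

theorem sgn_mul_self (γ : EucIsom n) (i : Fin n) : (sgn γ i : ℝ) * sgn γ i = 1 := by
  rcases sgn_eq γ i with h | h <;> simp [h]

theorem sgn_eq_one_iff (γ : EucIsom n) (i : Fin n) :
    sgn γ i = 1 ↔ linHom n γ (EuclideanSpace.single i 1) = EuclideanSpace.single i 1 := by
  unfold sgn
  split_ifs with h <;> simp [h]

theorem transVec_mul_trans (γ : EucIsom n) (c : EucSp n) :
    transVec (γ * trans c) = transVec γ + c := by
  have h : linHom n (γ * trans c) = linHom n γ := by
    rw [map_mul]
    have : linHom n (trans c) = 1 := by ext x; rfl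
    rw [this, mul_one]
  rw [transVec, h, LinearIsometryEquiv.symm_apply_eq]
  have := apply_eq_linHom γ c
  simp only [AffineIsometryEquiv.coe_mul, Function.comp_apply, trans,
    AffineIsometryEquiv.coe_constVAdd, vadd_eq_add, add_zero]
  rw [this, add_comm]

theorem linHom_mul_trans (γ : EucIsom n) (c : EucSp n) :
    linHom n (γ * trans c) = linHom n γ := by
  rw [map_mul]
  have : linHom n (trans c) = 1 := by ext x; rfl
  rw [this, mul_one]

theorem eq_trans_of_linHom_eq_one {γ : EucIsom n} (h : linHom n γ = 1) : γ = trans (γ 0) := by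
  ext1 x
  have h1 := apply_eq_linHom γ x
  have h2 := apply_eq_linHom γ 0
  rw [h] at h1 h2
  rw [zero_add] at h2
  rw [h1, h2]
  simp [trans, add_comm]

variable {Γ : Subgroup (EucIsom n)}

namespace IsDiagInt

theorem linHom_single (hΓ : IsDiagInt Γ) {γ : EucIsom n} (hγ : γ ∈ Γ) (i : Fin n) :
    linHom n γ (EuclideanSpace.single i 1) = (sgn γ i : ℝ) • EuclideanSpace.single i 1 := by
  by_cases h : linHom n γ (EuclideanSpace.single i 1) = EuclideanSpace.single i 1
  · rw [(sgn_eq_one_iff γ i).2 h, h]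
    simp
  · have h1 : sgn γ i = -1 := (sgn_eq γ i).resolve_left fun h2 => h ((sgn_eq_one_iff γ i).1 h2)
    rw [(hΓ.sign γ hγ i).resolve_left h, h1]
    simp

theorem linHom_apply (hΓ : IsDiagInt Γ) {γ : EucIsom n} (hγ : γ ∈ Γ) (x : EucSp n) (i : Fin n) :
    linHom n γ x i = sgn γ i * x i := by
  have hx : x = ∑ j, x j • EuclideanSpace.single j (1 : ℝ) := by
    ext j
    simp [Pi.single_apply]
  conv_lhs => rw [hx]
  simp only [map_sum, map_smul, hΓ.linHom_single hγ]
  simp [Pi.single_apply, mul_comm]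

theorem apply_coord (hΓ : IsDiagInt Γ) {γ : EucIsom n} (hγ : γ ∈ Γ) (x : EucSp n) (i : Fin n) :
    γ x i = sgn γ i * (x i + transVec γ i) := by
  rw [apply_eq_linHom, hΓ.linHom_apply hγ]
  rfl

/-- As `B² = Id`, the square is a translation, by `2b` in fixed coordinates and by 0 in reversed
ones. This yields both `b_i ∈ ½ℤ` and the torsion argument. -/
theorem mul_self_eq (hΓ : IsDiagInt Γ) {γ : EucIsom n} (hγ : γ ∈ Γ) :
    γ * γ = trans (WithLp.toLp 2 fun i => (1 + sgn γ i) * transVec γ i) := by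
  ext x i
  have h1 : (γ * γ) x = γ (γ x) := rfl
  rw [h1, hΓ.apply_coord hγ, hΓ.apply_coord hγ]
  have h2 := sgn_mul_self γ i
  simp [trans]
  linear_combination (x i + transVec γ i) * h2

theorem two_mul_transVec (hΓ : IsDiagInt Γ) {γ : EucIsom n} (hγ : γ ∈ Γ) {i : Fin n} (hi : sgn γ i = 1) :
    ∃ m : ℤ, 2 * transVec γ i = m := by
  have h := mul_mem hγ hγ
  rw [hΓ.mul_self_eq hγ, hΓ.lattice] at h
  obtain ⟨m, hm⟩ := h i
  refine ⟨m, ?_⟩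
  rw [← hm]
  simp [hi]
  norm_num

theorem int_or_half (hΓ : IsDiagInt Γ) {γ : EucIsom n} (hγ : γ ∈ Γ) {i : Fin n} (hi : sgn γ i = 1) :
    (∃ m : ℤ, transVec γ i = m) ∨ ∃ m : ℤ, transVec γ i = 1 / 2 + (m : ℝ) := by
  obtain ⟨m, hm⟩ := hΓ.two_mul_transVec hγ hi
  rcases Int.even_or_odd' m with ⟨k, rfl | rfl⟩
  · left
    refine ⟨k, ?_⟩
    push_cast at hm
    linarith
  · right
    refine ⟨k, ?_⟩
    push_cast at hm
    linarith

/-- If every fixed coordinate of `b` were an integer, a lattice translation would remove them all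
and leave an element of order two in `Γ`. -/
theorem exists_half (hΓ : IsDiagInt Γ) (htf : ∀ γ ∈ Γ, IsOfFinOrder γ → γ = 1) {γ : EucIsom n} (hγ : γ ∈ Γ)
    {j : Fin n} (hj : sgn γ j = -1) :
    ∃ i, sgn γ i = 1 ∧ ∃ m : ℤ, transVec γ i = 1 / 2 + (m : ℝ) := by
  by_contra! hcon
  have hint : ∀ i, sgn γ i = 1 → ∃ m : ℤ, transVec γ i = m := fun i hi =>
    (hΓ.int_or_half hγ hi).resolve_right fun ⟨m, hm⟩ => hcon i hi m hm
  -- Reversed coordinates need no correction, since they cancel in the square.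
  let c : EucSp n := WithLp.toLp 2 fun i => if sgn γ i = 1 then -transVec γ i else 0
  have hc : trans c ∈ Γ := by
    rw [hΓ.lattice]
    intro i
    by_cases hi : sgn γ i = 1
    · obtain ⟨m, hm⟩ := hint i hi
      exact ⟨-m, by simp [c, hi, hm]⟩
    · exact ⟨0, by simp [c, hi]⟩
  have hδ := mul_mem hγ hc
  have hsgn : ∀ i, sgn (γ * trans c) i = sgn γ i := fun i => by
    unfold sgn
    rw [linHom_mul_trans]
  have h2 : (γ * trans c) * (γ * trans c) = 1 := by
    rw [hΓ.mul_self_eq hδ]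
    ext x i
    rcases sgn_eq γ i with h | h
    · simp [hsgn, h, transVec_mul_trans, c, trans]
    · simp [hsgn, h, trans]
  have h1 := htf _ hδ (isOfFinOrder_iff_pow_eq_one.2 ⟨2, by norm_num, by rw [pow_two, h2]⟩)
  have h3 := hsgn j
  rw [h1, hj] at h3
  have h4 : sgn (1 : EucIsom n) j = 1 := by
    rw [sgn_eq_one_iff]
    rfl
  omega

/-- `B - Id` is diagonal with entries 0 and -2, and rank-nullity counts the zeros. -/
theorem fixDim_eq (hΓ : IsDiagInt Γ) {γ : EucIsom n} (hγ : γ ∈ Γ) :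
    fixDim γ = (Finset.univ.filter fun i => sgn γ i = 1).card := by
  let N := (linHom n γ).toLinearEquiv.toLinearMap - LinearMap.id
  let e := (EuclideanSpace.basisFun (Fin n) ℝ).toBasis
  have hM : LinearMap.toMatrix e e N = Matrix.diagonal fun i => ((sgn γ i : ℝ) - 1) := by
    ext i j
    rw [LinearMap.toMatrix_apply]
    have : e.repr (N (e j)) i = linHom n γ (EuclideanSpace.single j 1) i -
      (EuclideanSpace.single j (1 : ℝ) : EucSp n) i := by
      simp [N, e]
    rw [this, hΓ.linHom_single hγ, Matrix.diagonal_apply]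
    by_cases h : i = j
    · subst h; simp
    · simp [h]
  have hrank : Module.finrank ℝ (LinearMap.range N) =
      Fintype.card {i // (sgn γ i : ℝ) - 1 ≠ 0} := by
    classical
    have := Matrix.rank_diagonal (fun i : Fin n => ((sgn γ i : ℝ) - 1))
    rw [← hM, Matrix.rank_eq_finrank_range_toLin _ e e, Matrix.toLin_toMatrix] at this
    rw [this]
  have h1 := N.finrank_range_add_finrank_ker
  rw [hrank, finrank_euclideanSpace_fin, Fintype.card_subtype] at h1
  have h2 := Finset.card_filter_add_card_filter_not (s := (Finset.univ : Finset (Fin n)))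
    (fun i => sgn γ i = 1)
  have h3 : (Finset.univ.filter fun i => ¬ sgn γ i = 1) =
      Finset.univ.filter fun i => (sgn γ i : ℝ) - 1 ≠ 0 := by
    ext i
    simp only [Finset.mem_filter, Finset.mem_univ, true_and, ne_eq, sub_eq_zero]
    exact_mod_cast Iff.rfl
  rw [h3, Finset.card_univ, Fintype.card_fin] at h2
  change Module.finrank ℝ (LinearMap.ker N) = _
  omega

end IsDiagInt

open Classical in
theorem halfCount_eq (γ : EucIsom n) :
    halfCount γ = (Finset.univ.filter fun i => sgn γ i = 1 ∧
      ∃ m : ℤ, transVec γ i = 1 / 2 + (m : ℝ)).card := by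
  rw [halfCount, Nat.card_eq_fintype_card, Fintype.card_subtype]
  congr 1
  ext i
  simp only [Finset.mem_filter, Finset.mem_univ, true_and, sgn_eq_one_iff,
    EuclideanSpace.basisFun_apply, EuclideanSpace.inner_single_right]
  simp

theorem IsDiagInt.halfCount_le_fixDim (hΓ : IsDiagInt Γ) {γ : EucIsom n} (hγ : γ ∈ Γ) :
    halfCount γ ≤ fixDim γ := by
  classical
  rw [halfCount_eq, hΓ.fixDim_eq hγ]
  refine Finset.card_le_card fun i hi => ?_
  simp only [Finset.mem_filter] at hi ⊢
  exact ⟨hi.1, hi.2.1⟩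

theorem mk_eq_iff (γ δ : Γ) :
    (γ : Holonomy Γ) = (δ : Holonomy Γ) ↔ linHom n (γ : EucIsom n) = linHom n (δ : EucIsom n) := by
  rw [QuotientGroup.eq, MonoidHom.mem_ker, map_mul, map_inv, inv_mul_eq_one]
  rfl

theorem exists_trans_of_mk_eq {γ δ : Γ} (h : (γ : Holonomy Γ) = (δ : Holonomy Γ)) :
    ∃ c : EucSp n, trans c ∈ Γ ∧ (δ : EucIsom n) = γ * trans c := by
  rw [mk_eq_iff] at h
  have h1 : linHom n ((γ : EucIsom n)⁻¹ * δ) = 1 := by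
    rw [map_mul, map_inv, h, inv_mul_cancel]
  have h2 := eq_trans_of_linHom_eq_one h1
  refine ⟨((γ : EucIsom n)⁻¹ * δ) 0, ?_, ?_⟩
  · rw [← h2]
    exact mul_mem (inv_mem γ.2) δ.2
  · rw [← h2, mul_inv_cancel_left]

theorem fixDim_congr {γ δ : Γ} (h : (γ : Holonomy Γ) = (δ : Holonomy Γ)) :
    fixDim (γ : EucIsom n) = fixDim (δ : EucIsom n) := by
  rw [mk_eq_iff] at h
  rw [fixDim, fixDim, h]

theorem IsDiagInt.halfCount_congr (hΓ : IsDiagInt Γ) {γ δ : Γ} (h : (γ : Holonomy Γ) = (δ : Holonomy Γ)) :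
    halfCount (γ : EucIsom n) = halfCount (δ : EucIsom n) := by
  classical
  obtain ⟨c, hc, hδ⟩ := exists_trans_of_mk_eq h
  rw [hΓ.lattice] at hc
  rw [halfCount_eq, halfCount_eq, hδ]
  congr 1
  ext i
  obtain ⟨k, hk⟩ := hc i
  have hs : sgn ((γ : EucIsom n) * trans c) i = sgn (γ : EucIsom n) i := by
    unfold sgn
    rw [linHom_mul_trans]
  simp only [Finset.mem_filter, Finset.mem_univ, true_and, hs, transVec_mul_trans, PiLp.add_apply,
    hk]
  refine and_congr_right fun _ => ⟨fun ⟨m, hm⟩ => ⟨m + k, ?_⟩, fun ⟨m, hm⟩ => ⟨m - k, ?_⟩⟩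
  · rw [hm]; push_cast; ring
  · push_cast; linarith

/-- The signs of `B` determine `B`, and `B` determines the class, so `F` embeds in `{±1}ⁿ`. -/
theorem IsDiagInt.finite_holonomy (hΓ : IsDiagInt Γ) : Finite (Holonomy Γ) := by
  classical
  refine Finite.of_injective (β := Fin n → Bool)
    (fun q i => decide (sgn (q.out : EucIsom n) i = 1)) fun q r hqr => ?_
  have hs : ∀ i, sgn (q.out : EucIsom n) i = sgn (r.out : EucIsom n) i := by
    intro i
    have := congrFun hqr i
    simp only [decide_eq_decide] at this
    rcases sgn_eq (q.out : EucIsom n) i with h1 | h1 <;>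
      rcases sgn_eq (r.out : EucIsom n) i with h2 | h2 <;> simp_all
  rw [← q.out_eq', ← r.out_eq']
  refine (mk_eq_iff _ _).2 ?_
  ext x i
  rw [hΓ.linHom_apply q.out.2, hΓ.linHom_apply r.out.2, hs]

theorem fixDim_le (γ : EucIsom n) : fixDim γ ≤ n := by
  have := (LinearMap.ker ((linHom n γ).toLinearEquiv.toLinearMap - LinearMap.id)).finrank_le
  simpa [fixDim] using this

end Bieb

/-! ### Torus eigenforms as a representation of the holonomy group -/

namespace Bieb

open MeasureTheory InnerProductSpace

variable {n p : ℕ} {Γ : Subgroup (EucIsom n)}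

/-- The average of the group action projects onto the invariants, so its trace is their dimension.
-/
theorem sum_trace_eq_card_mul_finrank_invariants {V G : Type} [AddCommGroup V] [Module ℂ V]
    [Module.Finite ℂ V] [Group G] [Finite G] (ρ : Representation ℂ G V) :
    ∑ᶠ g, LinearMap.trace ℂ V (ρ g) = Nat.card G * Module.finrank ℂ ρ.invariants := by
  have : Fintype G := Fintype.ofFinite G
  have : Invertible (Nat.card G : ℂ) := invertibleOfNonzero (by simp)
  have h := FDRep.average_char_eq_finrank_invariants (FDRep.of ρ)
  have h2 : (Nat.card G : ℂ) ≠ 0 := by simp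
  rw [inv_mul_eq_iff_eq_mul₀ h2] at h
  rw [finsum_eq_sum_of_fintype]
  exact h

/-- The `p`-form `exp (2 π i u ⬝ x) dx_I` on `ℝⁿ`. -/
noncomputable def mode (u : Fin n → ℤ) (I : FormIdx n p) : EucSp n → Alt n p :=
  fun x => expChar u x • stdForm I

/-- Evaluation on `stdVec J` isolates the `dx_J` component and reduces the claim to independence of
characters. -/
theorem linearIndependent_mode :
    LinearIndependent ℂ (fun k : (Fin n → ℤ) × FormIdx n p => mode k.1 k.2) := by
  classical
  rw [linearIndependent_iff']
  rintro s g hg ⟨v, J⟩ hk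
  have hchar := linearIndependent_iff'.1 (linearIndependent_expChar (n := n))
    (s.image Prod.fst) (fun u => if (u, J) ∈ s then g (u, J) else 0) ?_ v
    (Finset.mem_image_of_mem _ hk)
  · simpa [hk] using hchar
  · funext x
    have h1 := congrArg (fun η : EucSp n → Alt n p => η x (stdVec J)) hg
    simp only [Finset.sum_apply, Pi.smul_apply, ContinuousAlternatingMap.sum_apply, mode,
      ContinuousAlternatingMap.smul_apply, stdForm_stdVec, Pi.zero_apply] at h1
    rw [show (0 : Alt n p) (stdVec J) = 0 from rfl] at h1
    simp only [Finset.sum_apply, Pi.smul_apply, Pi.zero_apply]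
    refine Eq.trans ?_ h1
    have h2 : ∀ k ∈ s, g k • expChar k.1 x • (if k.2 = J then (1 : ℂ) else 0) =
        if k.2 = J then g k • expChar k.1 x else 0 := by
      intro k _
      split_ifs <;> simp
    have h3 : ∀ u ∈ s.image Prod.fst, (if (u, J) ∈ s then g (u, J) else 0) • expChar u x =
        if (u, J) ∈ s then g (u, J) • expChar u x else 0 := by
      intro u _
      split_ifs <;> simp
    rw [Finset.sum_congr rfl h3, Finset.sum_congr rfl h2, ← Finset.sum_filter, ← Finset.sum_filter]
    refine Finset.sum_bij (fun u _ => (u, J)) ?_ ?_ ?_ ?_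
    · intro u hu
      simp only [Finset.mem_filter] at hu ⊢
      exact ⟨hu.2, trivial⟩
    · intro u _ u' _ h
      exact (Prod.mk.inj h).1
    · rintro ⟨u, I⟩ h
      simp only [Finset.mem_filter] at h
      obtain ⟨h, rfl⟩ := h
      exact ⟨u, Finset.mem_filter.2 ⟨Finset.mem_image_of_mem Prod.fst h, h⟩, rfl⟩
    · intro u _
      rfl

/-- Pullback of differential forms as a linear map. -/
noncomputable def pullbackLin (γ : EucIsom n) :
    (EucSp n → Alt n p) →ₗ[ℂ] (EucSp n → Alt n p) where
  toFun := pullback γ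
  map_add' _ _ := rfl
  map_smul' _ _ := rfl

theorem pullback_mul (γ δ : EucIsom n) (η : EucSp n → Alt n p) :
    pullback (γ * δ) η = pullback δ (pullback γ η) := rfl

theorem pullback_one (η : EucSp n → Alt n p) : pullback 1 η = η := rfl

theorem pullback_trans (c : EucSp n) (η : EucSp n → Alt n p) (x : EucSp n) :
    pullback (trans c) η x = η (x + c) := by
  have : trans c x = x + c := by simp [trans, add_comm]
  unfold pullback
  rw [this]
  rfl

/-- The action of the rotational part of `γ` on frequency vectors. -/
noncomputable def flip (γ : EucIsom n) (u : Fin n → ℤ) : Fin n → ℤ := fun i => sgn γ i * u i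

theorem eigVal_flip (γ : EucIsom n) (u : Fin n → ℤ) : eigVal (flip γ u) = eigVal u := by
  unfold eigVal
  congr 1
  refine Finset.sum_congr rfl fun i _ => ?_
  rcases sgn_eq γ i with h | h <;> simp [flip, h]

/-- `B` is symmetric, so `u ⬝ B(x + b) = Bu ⬝ x + Bu ⬝ b`; on `dx_I` the map `B` acts by the product
of its signs over `I`. -/
theorem pullback_mode (hΓ : IsDiagInt Γ) {γ : EucIsom n} (hγ : γ ∈ Γ) (u : Fin n → ℤ)
    (I : FormIdx n p) :
    pullback γ (mode u I) = (((∏ i ∈ (I : Finset (Fin n)), sgn γ i : ℤ) : ℂ) *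
      expChar (flip γ u) (transVec γ)) • mode (flip γ u) I := by
  funext x
  have h1 : expChar u (γ x) = expChar (flip γ u) x * expChar (flip γ u) (transVec γ) := by
    rw [← expChar_add]
    unfold expChar
    congr 2
    refine Finset.sum_congr rfl fun i _ => ?_
    rw [hΓ.apply_coord hγ]
    simp [flip]
    ring
  have h2 := stdForm_compContinuousLinearMap I
    ((linHom n γ).toContinuousLinearEquiv : EucSp n →L[ℝ] EucSp n) (sgn γ)
    (fun x i => hΓ.linHom_apply hγ x i)
  have h3 : pullback γ (mode u I) x = expChar u (γ x) • (stdForm I).compContinuousLinearMap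
    ((linHom n γ).toContinuousLinearEquiv : EucSp n →L[ℝ] EucSp n) := rfl
  rw [h3, h2, h1]
  simp only [mode, Pi.smul_apply, smul_smul]
  congr 1
  ring

/-- Frequency vectors with a given eigenvalue. -/
abbrev Freq (n : ℕ) (μ : ℝ) : Type := {u : Fin n → ℤ // eigVal u = μ}

/-- The action of the rotational part of `γ` on the frequency vectors with a given eigenvalue. -/
noncomputable def flipFreq (γ : EucIsom n) {μ : ℝ} (u : Freq n μ) : Freq n μ :=
  ⟨flip γ u.1, (eigVal_flip γ u.1).trans u.2⟩

noncomputable instance (n : ℕ) (μ : ℝ) : Fintype (Freq n μ) := (finite_eigVal μ).fintype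

theorem linearIndependent_mode_freq (μ : ℝ) :
    LinearIndependent ℂ (fun k : Freq n μ × FormIdx n p => mode k.1.1 k.2) :=
  linearIndependent_mode.comp (fun k : Freq n μ × FormIdx n p => (k.1.1, k.2))
    (fun k l h => by
      simp only [Prod.mk.injEq] at h
      exact Prod.ext (Subtype.ext h.1) h.2)

/-- The eigenspace of the torus `ℤⁿ \ ℝⁿ`. -/
noncomputable abbrev torusForms (n p : ℕ) (μ : ℝ) : Submodule ℂ (EucSp n → Alt n p) :=
  Submodule.span ℂ (Set.range fun k : Freq n μ × FormIdx n p => mode k.1.1 k.2)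

/-- The basis of the torus eigenspace consisting of the forms `exp (2 π i u ⬝ x) dx_I`. -/
noncomputable def modeBasis (n p : ℕ) (μ : ℝ) :
    Module.Basis (Freq n μ × FormIdx n p) ℂ (torusForms n p μ) :=
  Module.Basis.span (linearIndependent_mode_freq μ)

theorem modeBasis_coe (μ : ℝ) (k : Freq n μ × FormIdx n p) :
    (modeBasis n p μ k : EucSp n → Alt n p) = mode k.1.1 k.2 := by
  simp [modeBasis, Module.Basis.span_apply]

theorem pullback_mem_torusForms (hΓ : IsDiagInt Γ) {γ : EucIsom n} (hγ : γ ∈ Γ) {μ : ℝ} :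
    ∀ η : EucSp n → Alt n p, η ∈ torusForms n p μ → pullbackLin γ η ∈ torusForms n p μ := by
  intro η hη
  have : torusForms n p μ ≤ (torusForms n p μ).comap (pullbackLin γ) := by
    rw [Submodule.span_le]
    rintro _ ⟨⟨u, I⟩, rfl⟩
    change pullback γ (mode u.1 I) ∈ torusForms n p μ
    rw [pullback_mode hΓ hγ]
    exact Submodule.smul_mem _ _ (Submodule.subset_span
      ⟨(flipFreq γ u, I), rfl⟩)
  exact this hη

/-- The representation of `Γ` on the torus eigenspace, by pullback under inverses. -/
noncomputable def torusRep (hΓ : IsDiagInt Γ) (p : ℕ) (μ : ℝ) :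
    Representation ℂ Γ (torusForms n p μ) where
  toFun γ := (pullbackLin (γ⁻¹ : Γ)).restrict (pullback_mem_torusForms hΓ (γ⁻¹ : Γ).2)
  map_one' := by
    ext η : 2
    change pullback ((1⁻¹ : Γ) : EucIsom n) (η : EucSp n → Alt n p) = η
    rw [inv_one]
    exact pullback_one _
  map_mul' γ δ := by
    ext η : 2
    change pullback (((γ * δ)⁻¹ : Γ) : EucIsom n) (η : EucSp n → Alt n p) = _
    rw [mul_inv_rev]
    exact pullback_mul _ _ _

theorem torusRep_coe (hΓ : IsDiagInt Γ) (μ : ℝ) (γ : Γ) (η : torusForms n p μ) :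
    (torusRep hΓ p μ γ η : EucSp n → Alt n p) = pullback ((γ⁻¹ : Γ) : EucIsom n) η := rfl

theorem torusRep_inv_modeBasis (hΓ : IsDiagInt Γ) (μ : ℝ) (γ : Γ) (k : Freq n μ × FormIdx n p) :
    torusRep hΓ p μ γ⁻¹ (modeBasis n p μ k) =
      (((∏ i ∈ (k.2 : Finset (Fin n)), sgn (γ : EucIsom n) i : ℤ) : ℂ) *
      expChar (flip (γ : EucIsom n) k.1.1) (transVec (γ : EucIsom n))) •
        modeBasis n p μ (flipFreq (γ : EucIsom n) k.1, k.2) := by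
  apply Subtype.ext
  rw [torusRep_coe, inv_inv, modeBasis_coe, pullback_mode hΓ γ.2, Submodule.coe_smul, modeBasis_coe]
  rfl

/-- Elements with `B = Id` are integral translations, and these fix every character; hence the
action descends to `F`. -/
theorem ker_le_ker_torusRep (hΓ : IsDiagInt Γ) (p : ℕ) (μ : ℝ) :
    ((linHom n).comp Γ.subtype).ker ≤ (torusRep hΓ p μ).ker := by
  intro γ hγ
  have hγ' := inv_mem hγ
  rw [MonoidHom.mem_ker] at hγ' ⊢
  have h1 := eq_trans_of_linHom_eq_one (γ := ((γ⁻¹ : Γ) : EucIsom n)) hγ'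
  set c := ((γ⁻¹ : Γ) : EucIsom n) 0 with hc
  have hcm : trans c ∈ Γ := h1 ▸ (γ⁻¹ : Γ).2
  rw [hΓ.lattice] at hcm
  refine (modeBasis n p μ).ext fun k => Subtype.ext ?_
  rw [torusRep_coe, modeBasis_coe, h1, Module.End.one_apply, modeBasis_coe]
  funext x
  rw [pullback_trans, mode, expChar_add, expChar_of_int _ c hcm, mul_one, mode]

/-- The representation of the holonomy group on the torus eigenspace. -/
noncomputable def holRep (hΓ : IsDiagInt Γ) (p : ℕ) (μ : ℝ) :
    Representation ℂ (Holonomy Γ) (torusForms n p μ) :=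
  QuotientGroup.lift _ (torusRep hΓ p μ) (ker_le_ker_torusRep hΓ p μ)

theorem holRep_mk (hΓ : IsDiagInt Γ) (μ : ℝ) (γ : Γ) :
    holRep hΓ p μ (γ : Holonomy Γ) = torusRep hΓ p μ γ := rfl

/-- The sum of `exp (2 π i u ⬝ b)` over the frequency vectors `u` with eigenvalue `μ` that are fixed
by `B`. -/
noncomputable def fixedSum (γ : EucIsom n) (μ : ℝ) : ℂ :=
  ∑ u : Freq n μ, open Classical in
    if flip γ u.1 = u.1 then expChar u.1 (transVec γ) else 0

open Classical in
theorem repr_eq_of_eq_smul {ι V : Type*} [AddCommMonoid V] [Module ℂ V] (b : Module.Basis ι ℂ V)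
    {w : V} {c : ℂ} {i j : ι} (h : w = c • b j) : b.repr w i = if j = i then c else 0 := by
  rw [h, map_smul, Finsupp.smul_apply, Module.Basis.repr_self, Finsupp.single_apply]
  simp

/-- Only modes with `Bu = u` meet the diagonal. There the entry is a product of a sign depending on
`I` and a phase depending on `u`, so the trace factors. The inverse undoes the one in `torusRep`. -/
theorem trace_torusRep_inv (hΓ : IsDiagInt Γ) (μ : ℝ) (γ : Γ) :
    LinearMap.trace ℂ _ (torusRep hΓ p μ γ⁻¹) =
      (krawtchouk n p ((n : ℤ) - fixDim (γ : EucIsom n)) : ℂ) * fixedSum (γ : EucIsom n) μ := by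
  classical
  rw [LinearMap.trace_eq_matrix_trace ℂ (modeBasis n p μ), Matrix.trace, Fintype.sum_prod_type,
    hΓ.fixDim_eq γ.2, ← sum_prod_sign _ (sgn_eq _), fixedSum, Finset.mul_sum]
  refine Finset.sum_congr rfl fun u _ => ?_
  push_cast
  rw [Finset.sum_mul]
  refine Finset.sum_congr rfl fun I _ => ?_
  rw [Matrix.diag_apply, LinearMap.toMatrix_apply,
    repr_eq_of_eq_smul _ (torusRep_inv_modeBasis hΓ μ γ (u, I))]
  by_cases h : flip (γ : EucIsom n) u.1 = u.1
  · have h' : flipFreq (γ : EucIsom n) u = u := Subtype.ext h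
    simp [h, h']
  · have h' : ¬ (flipFreq (γ : EucIsom n) u, I) = (u, I) := by
      intro e
      exact h (congrArg Subtype.val (Prod.mk.inj e).1)
    simp [h, h']

theorem pullback_inv_eq_iff (γ : EucIsom n) (η : EucSp n → Alt n p) :
    pullback γ⁻¹ η = η ↔ pullback γ η = η := by
  constructor
  · intro h
    conv_lhs => rw [← h]
    rw [← pullback_mul, inv_mul_cancel, pullback_one]
  · intro h
    conv_lhs => rw [← h]
    rw [← pullback_mul, mul_inv_cancel, pullback_one]

/-- The trivial group makes the invariance condition vacuous, so this records smoothness and the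
eigenvalue equation alone. -/
theorem torusForms_le_eigenforms_bot (μ : ℝ) :
    torusForms n p μ ≤ eigenforms (⊥ : Subgroup (EucIsom n)) p μ := by
  rw [Submodule.span_le]
  rintro _ ⟨⟨⟨u, hu⟩, I⟩, rfl⟩
  let L : ℂ →L[ℝ] Alt n p :=
    (ContinuousLinearMap.toSpanSingleton ℂ (stdForm I)).restrictScalars ℝ
  have hL : mode u I = L ∘ expChar u := by
    funext x
    simp [mode, L]
  refine ⟨?_, ?_, ?_⟩
  · change ContDiff ℝ _ (mode u I)
    rw [hL]
    exact L.contDiff.comp (contDiff_expChar u)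
  · intro γ hγ
    rw [Subgroup.mem_bot] at hγ
    rw [hγ]
    rfl
  · intro x
    change -(Laplacian.laplacian (mode u I) x) = (μ : ℂ) • mode u I x
    rw [hL, (contDiff_expChar u (k := 2)).contDiffAt.laplacian_CLM_comp_left,
      Function.comp_apply, laplacian_expChar, hu]
    simp [L, smul_smul]

/-- Each coefficient of an eigenform in the constant frame `dx_I` is a periodic scalar
eigenfunction, hence a finite sum of characters. -/
theorem eigenforms_le_torusForms (hn : 1 ≤ n) (hΓ : IsDiagInt Γ) (μ : ℝ) :
    eigenforms Γ p μ ≤ torusForms n p μ := by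
  rintro η ⟨hs, hinv, heig⟩
  have hper : StdPeriodic η := by
    intro i x
    have hm : trans (EuclideanSpace.single i (1 : ℝ) : EucSp n) ∈ Γ := by
      rw [hΓ.lattice]
      intro j
      by_cases h : j = i
      · exact ⟨1, by simp [h]⟩
      · exact ⟨0, by simp [h]⟩
    have := congrFun (hinv _ hm) x
    rwa [pullback_trans] at this
  have hs2 : ContDiff ℝ 2 η := contDiff_infty.1 hs 2
  have hcomp : ∀ I : FormIdx n p, ∃ c : (Fin n → ℤ) → ℂ, (fun x => η x (stdVec I)) =
      ∑ u ∈ (finite_eigVal μ).toFinset, c u • expChar u := by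
    intro I
    let L : Alt n p →L[ℝ] ℂ := ContinuousAlternatingMap.apply ℝ (EucSp n) ℂ (stdVec I)
    have hL : (fun x => η x (stdVec I)) = L ∘ η := rfl
    rw [hL]
    refine eigenfunction_eq_sum hn (L.contDiff.comp hs2) ?_ μ ?_
    · intro i x
      simp only [Function.comp_apply, hper i x]
    · intro x
      rw [hs2.contDiffAt.laplacian_CLM_comp_left, Function.comp_apply, Function.comp_apply,
        ← map_neg, heig x]
      rfl
  choose c hc using hcomp
  have hη : η = ∑ I : FormIdx n p, ∑ u ∈ (finite_eigVal μ).toFinset, c I u • mode u I := by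
    funext x
    rw [Alt.eq_sum_stdForm (η x), Finset.sum_apply]
    refine Finset.sum_congr rfl fun I _ => ?_
    have := congrFun (hc I) x
    rw [this]
    simp only [Finset.sum_apply, Pi.smul_apply, mode]
    refine (Finset.sum_smul (R := ℂ) (M := Alt n p)).trans (Finset.sum_congr rfl fun u _ => ?_)
    exact smul_assoc (c I u) (expChar u x) (stdForm I)
  rw [hη]
  refine sum_mem fun I _ => sum_mem fun u hu => Submodule.smul_mem _ _ (Submodule.subset_span ?_)
  have hu' : eigVal u = μ := by simpa using hu
  exact ⟨(⟨u, hu'⟩, I), rfl⟩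

theorem map_invariants_holRep (hn : 1 ≤ n) (hΓ : IsDiagInt Γ) (μ : ℝ) :
    (Representation.invariants (V := torusForms n p μ) (holRep hΓ p μ)).map (torusForms n p μ).subtype = eigenforms Γ p μ := by
  apply le_antisymm
  · rintro _ ⟨η, hη, rfl⟩
    obtain ⟨h1, -, h3⟩ := torusForms_le_eigenforms_bot μ η.2
    refine ⟨h1, fun γ hγ => ?_, h3⟩
    have h4 := congrArg Subtype.val (hη ((⟨γ, hγ⟩ : Γ) : Holonomy Γ))
    rw [holRep_mk, torusRep_coe] at h4
    exact (pullback_inv_eq_iff γ _).1 h4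
  · intro η hη
    refine ⟨⟨η, eigenforms_le_torusForms hn hΓ μ hη⟩, fun q => ?_, rfl⟩
    induction q using QuotientGroup.induction_on with
    | H γ =>
      apply Subtype.ext
      rw [holRep_mk, torusRep_coe]
      exact hη.2.1 _ (γ⁻¹ : Γ).2

instance (μ : ℝ) : Module.Finite ℂ (torusForms n p μ) :=
  Module.Finite.of_basis (modeBasis n p μ)

theorem finiteDimensional_eigenforms (hn : 1 ≤ n) (hΓ : IsDiagInt Γ) (μ : ℝ) :
    FiniteDimensional ℂ (eigenforms Γ p μ) :=
  Submodule.finiteDimensional_of_le (eigenforms_le_torusForms hn hΓ μ)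

/-- The multiplicity formula: averaging the traces of the holonomy group. -/
theorem card_mul_multiplicity (hn : 1 ≤ n) (hΓ : IsDiagInt Γ) [Fintype (Holonomy Γ)] (μ : ℝ) :
    (Nat.card (Holonomy Γ) : ℂ) * multiplicity Γ p μ =
      ∑ q : Holonomy Γ, (krawtchouk n p ((n : ℤ) - fixDim (q.out : EucIsom n)) : ℂ) *
        fixedSum (q.out : EucIsom n) μ := by
  have h1 : multiplicity Γ p μ = Module.finrank ℂ (Representation.invariants (V := torusForms n p μ) (holRep hΓ p μ)) := by
    rw [multiplicity, ← map_invariants_holRep hn hΓ μ]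
    exact (Submodule.equivMapOfInjective _ (Submodule.subtype_injective _) _).finrank_eq.symm
  -- The sum is reindexed by `q ↦ q⁻¹` because the traces were computed at inverses.
  rw [h1, ← sum_trace_eq_card_mul_finrank_invariants (V := torusForms n p μ) (holRep hΓ p μ), finsum_eq_sum_of_fintype,
    ← Equiv.sum_comp (Equiv.inv (Holonomy Γ))]
  refine Finset.sum_congr rfl fun q _ => ?_
  rw [← trace_torusRep_inv hΓ μ q.out, ← holRep_mk, QuotientGroup.mk_inv,
    QuotientGroup.out_eq']
  rfl

end Bieb

/-! ### The heat trace as a sum of products of theta functions -/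

namespace Bieb

variable {n p : ℕ} {Γ : Subgroup (EucIsom n)}

/-- Induction on the dimension; absolute summability is carried along because multiplying the series
requires it. -/
theorem hasSum_prod_pi {n : ℕ} (h : Fin n → ℤ → ℂ) (hs : ∀ i, Summable fun m => ‖h i m‖) :
    (Summable fun u : Fin n → ℤ => ‖∏ i, h i (u i)‖) ∧
      HasSum (fun u : Fin n → ℤ => ∏ i, h i (u i)) (∏ i, ∑' m, h i m) := by
  induction n with
  | zero => exact ⟨(hasSum_fintype _).summable, by simp⟩
  | succ n ih =>
    obtain ⟨ih1, ih2⟩ := ih (fun i => h i.succ) (fun i => hs i.succ)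
    have e : ∀ x : ℤ × (Fin n → ℤ), ∏ i, h i (Fin.consEquiv (fun _ => ℤ) x i) =
        h 0 x.1 * ∏ i : Fin n, h i.succ (x.2 i) := by
      intro x
      rw [Fin.prod_univ_succ]
      simp [Fin.consEquiv]
    have h1 := (hs 0).mul_norm ih1
    constructor
    · rw [← (Fin.consEquiv (fun _ => ℤ)).summable_iff]
      refine h1.congr fun x => ?_
      rw [Function.comp_apply, e]
    · rw [← (Fin.consEquiv (fun _ => ℤ)).hasSum_iff, Fin.prod_univ_succ]
      have h2 := (hs 0).of_norm.hasSum.mul ih2 h1.of_norm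
      refine h2.congr_fun fun x => ?_
      rw [Function.comp_apply, e]

/-- The parameter `4 π s i` of the Jacobi theta function. -/
noncomputable def thetaParam (s : ℂ) : ℂ := 4 * Real.pi * s * Complex.I

theorem thetaParam_im (s : ℂ) : (thetaParam s).im = 4 * Real.pi * s.re := by
  have : thetaParam s = ((4 * Real.pi : ℝ) : ℂ) * s * Complex.I := by
    simp [thetaParam]
  rw [this]
  simp

/-- The functional equation of the theta function converts the spectral side `∑ exp(-4π²m²s)` into
the Gaussian sum defining `x`. -/
theorem jacobiTheta₂_zero_eq_xFun {s : ℂ} (hs : 0 < s.re) :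
    jacobiTheta₂ 0 (thetaParam s) = xFun s := by
  have hs0 : s ≠ 0 := by rintro rfl; simp at hs
  have hpi : (Real.pi : ℂ) ≠ 0 := by exact_mod_cast Real.pi_ne_zero
  rw [jacobiTheta₂_functional_equation, xFun, theta0]
  have h1 : -Complex.I * thetaParam s = 4 * Real.pi * s := by
    unfold thetaParam
    linear_combination (-4 * Real.pi * s) * Complex.I_sq
  rw [h1]
  have h2 : jacobiTheta₂ (0 / thetaParam s) (-1 / thetaParam s) =
      ∑' m : ℤ, Complex.exp (-(1 / (4 * s)) * (m : ℂ) ^ 2) := by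
    unfold jacobiTheta₂ jacobiTheta₂_term
    congr 1
    funext m
    congr 1
    unfold thetaParam
    field_simp
    simp [pow_two]
  rw [h2]
  simp
  ring

theorem jacobiTheta₂_half_eq_yFun {s : ℂ} (hs : 0 < s.re) :
    jacobiTheta₂ (1 / 2) (thetaParam s) = yFun s := by
  have hs0 : s ≠ 0 := by rintro rfl; simp at hs
  have hpi : (Real.pi : ℂ) ≠ 0 := by exact_mod_cast Real.pi_ne_zero
  rw [jacobiTheta₂_functional_equation, yFun, theta1]
  have h1 : -Complex.I * thetaParam s = 4 * Real.pi * s := by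
    unfold thetaParam
    linear_combination (-4 * Real.pi * s) * Complex.I_sq
  -- The Gaussian prefactor completes the square to `(1/2 - m)²`; the substitution `m ↦ -m` matches
  -- the definition of `y`.
  rw [h1, mul_assoc, jacobiTheta₂, ← tsum_mul_left, ← (Equiv.neg ℤ).tsum_eq]
  rw [one_div_mul_eq_div]
  congr 2
  funext m
  rw [jacobiTheta₂_term, ← Complex.exp_add]
  congr 1
  unfold thetaParam
  rw [Equiv.neg_apply]
  push_cast
  field_simp
  ring

/-- The theta function at `z` only depends on `z` modulo `ℤ`. -/
theorem jacobiTheta₂_add_int (z τ : ℂ) (k : ℤ) : jacobiTheta₂ (z + k) τ = jacobiTheta₂ z τ := by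
  unfold jacobiTheta₂ jacobiTheta₂_term
  congr 1
  funext m
  rw [Complex.exp_eq_exp_iff_exists_int]
  refine ⟨m * k, ?_⟩
  push_cast
  ring

open Classical in
/-- The one-dimensional factor of the heat trace of `γ` in the `i`-th direction. -/
noncomputable def heatFactor (γ : EucIsom n) (s : ℂ) (i : Fin n) (m : ℤ) : ℂ :=
  if sgn γ i * m = m then jacobiTheta₂_term m (transVec γ i : ℂ) (thetaParam s) else 0

theorem summable_heatFactor (γ : EucIsom n) {s : ℂ} (hs : 0 < s.re) (i : Fin n) :
    Summable fun m => ‖heatFactor γ s i m‖ := by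
  have h : Summable fun m => ‖jacobiTheta₂_term m (transVec γ i : ℂ) (thetaParam s)‖ := by
    refine ((summable_jacobiTheta₂_term_iff _ _).2 ?_).norm
    rw [thetaParam_im]
    have := Real.pi_pos
    positivity
  refine Summable.of_nonneg_of_le (fun _ => norm_nonneg _) (fun m => ?_) h
  unfold heatFactor
  split_ifs
  · exact le_rfl
  · simp

-- In a fixed direction only `b_i` modulo `ℤ` matters, that is 0 or 1/2. In a reversed direction `-m
-- = m` leaves only `m = 0`.
open Classical in
theorem tsum_heatFactor (hΓ : IsDiagInt Γ) {γ : EucIsom n} (hγ : γ ∈ Γ) {s : ℂ} (hs : 0 < s.re)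
    (i : Fin n) : ∑' m, heatFactor γ s i m = if sgn γ i = 1 then
      (if ∃ m : ℤ, transVec γ i = 1 / 2 + (m : ℝ) then yFun s else xFun s) else 1 := by
  split_ifs with h1 h2
  · obtain ⟨k, hk⟩ := h2
    simp only [heatFactor, h1, one_mul, if_true]
    rw [← jacobiTheta₂_half_eq_yFun hs, ← jacobiTheta₂_add_int _ _ k, hk]
    push_cast
    rfl
  · obtain ⟨k, hk⟩ := (hΓ.int_or_half hγ h1).resolve_right h2
    simp only [heatFactor, h1, one_mul, if_true]
    rw [← jacobiTheta₂_zero_eq_xFun hs, ← jacobiTheta₂_add_int _ _ k, hk]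
    push_cast
    rw [zero_add]
    rfl
  · have h2 := (sgn_eq γ i).resolve_left h1
    rw [tsum_eq_single 0]
    · simp [heatFactor, jacobiTheta₂_term]
    · intro m hm
      rw [heatFactor, if_neg]
      rw [h2]
      omega

open Classical in
theorem prod_heatFactor (γ : EucIsom n) (s : ℂ) (u : Fin n → ℤ) :
    ∏ i, heatFactor γ s i (u i) =
      if flip γ u = u then expChar u (transVec γ) * Complex.exp (-(eigVal u : ℂ) * s) else 0 := by
  split_ifs with h
  · have h1 : ∀ i, heatFactor γ s i (u i) =
        jacobiTheta₂_term (u i) (transVec γ i : ℂ) (thetaParam s) := by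
      intro i
      exact if_pos (congrFun h i)
    simp only [h1, jacobiTheta₂_term]
    rw [← Complex.exp_sum, expChar, ← Complex.exp_add]
    congr 1
    rw [Finset.sum_add_distrib, Finset.mul_sum]
    congr 1
    · refine Finset.sum_congr rfl fun i _ => ?_
      ring
    · rw [eigVal]
      push_cast
      rw [← neg_mul, mul_assoc, mul_comm _ s, Finset.mul_sum, Finset.mul_sum]
      refine Finset.sum_congr rfl fun i _ => ?_
      unfold thetaParam
      linear_combination (4 * Real.pi ^ 2 * s * (u i : ℂ) ^ 2) * Complex.I_sq
  · obtain ⟨i, hi⟩ := Function.ne_iff.1 h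
    refine Finset.prod_eq_zero (Finset.mem_univ i) ?_
    rw [heatFactor, if_neg]
    exact hi

theorem prod_tsum_heatFactor (hΓ : IsDiagInt Γ) {γ : EucIsom n} (hγ : γ ∈ Γ) {s : ℂ}
    (hs : 0 < s.re) : ∏ i, ∑' m, heatFactor γ s i m =
      xFun s ^ (fixDim γ - halfCount γ) * yFun s ^ halfCount γ := by
  classical
  simp only [tsum_heatFactor hΓ hγ hs]
  rw [← Finset.prod_filter, Finset.prod_ite, Finset.prod_const, Finset.prod_const, mul_comm,
    hΓ.fixDim_eq hγ, halfCount_eq, Finset.filter_filter, Finset.filter_filter]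
  congr 2
  have h := Finset.card_filter_add_card_filter_not (s := Finset.univ.filter fun i => sgn γ i = 1)
    (fun i => ∃ m : ℤ, transVec γ i = 1 / 2 + (m : ℝ))
  rw [Finset.filter_filter, Finset.filter_filter] at h
  omega

/-- The contribution of one isometry to the heat trace. -/
theorem hasSum_fixedSum (hΓ : IsDiagInt Γ) {γ : EucIsom n} (hγ : γ ∈ Γ) {s : ℂ}
    (hs : 0 < s.re) : HasSum (fun μ : ℝ => fixedSum γ μ * Complex.exp (-(μ : ℂ) * s))
      (xFun s ^ (fixDim γ - halfCount γ) * yFun s ^ halfCount γ) := by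
  classical
  rw [← prod_tsum_heatFactor hΓ hγ hs]
  -- The sum over all frequency vectors is grouped by eigenvalue; each fiber is finite.
  have h := (hasSum_prod_pi _ (summable_heatFactor γ hs)).2.tsum_fiberwise
    (eigVal : (Fin n → ℤ) → ℝ)
  refine h.congr_fun fun μ => ?_
  have h1 : ∑' u : ((eigVal : (Fin n → ℤ) → ℝ) ⁻¹' {μ} : Set (Fin n → ℤ)),
      ∏ i, heatFactor γ s i (u.1 i) = ∑ u : Freq n μ, ∏ i, heatFactor γ s i (u.1 i) :=
    tsum_fintype (L := SummationFilter.unconditional (Freq n μ)) (fun u : Freq n μ => ∏ i, heatFactor γ s i (u.1 i))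
  rw [h1, fixedSum, Finset.sum_mul]
  refine Finset.sum_congr rfl fun u _ => ?_
  rw [prod_heatFactor, u.2]
  split_ifs <;> simp

/-- The heat trace formula. -/
theorem hasSum_heatTerm (hn : 1 ≤ n) (hΓ : IsDiagInt Γ) [Fintype (Holonomy Γ)] (p : ℕ) {s : ℂ}
    (hs : 0 < s.re) : HasSum (fun μ => (Nat.card (Holonomy Γ) : ℂ) * heatTerm Γ p s μ)
      (∑ q : Holonomy Γ, (krawtchouk n p ((n : ℤ) - fixDim (q.out : EucIsom n)) : ℂ) *
        (xFun s ^ (fixDim (q.out : EucIsom n) - halfCount (q.out : EucIsom n)) *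
          yFun s ^ halfCount (q.out : EucIsom n))) := by
  refine (hasSum_sum fun q _ => (hasSum_fixedSum hΓ q.out.2 hs).mul_left _).congr_fun fun μ => ?_
  rw [heatTerm, ← mul_assoc, card_mul_multiplicity hn hΓ, Finset.sum_mul]
  refine Finset.sum_congr rfl fun q _ => ?_
  ring

theorem card_holonomy_ne_zero (hΓ : IsDiagInt Γ) : (Nat.card (Holonomy Γ) : ℂ) ≠ 0 := by
  have := hΓ.finite_holonomy
  exact_mod_cast Nat.card_pos.ne'

theorem summable_heatTerm (hn : 1 ≤ n) (hΓ : IsDiagInt Γ) (p : ℕ) {s : ℂ} (hs : 0 < s.re) :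
    Summable (heatTerm Γ p s) := by
  have := hΓ.finite_holonomy
  have := Fintype.ofFinite (Holonomy Γ)
  exact (summable_mul_left_iff (card_holonomy_ne_zero hΓ)).1 (hasSum_heatTerm hn hΓ p hs).summable

theorem card_mul_heatTrace (hn : 1 ≤ n) (hΓ : IsDiagInt Γ) [Fintype (Holonomy Γ)] (p : ℕ) {s : ℂ}
    (hs : 0 < s.re) : (Nat.card (Holonomy Γ) : ℂ) * heatTrace Γ p s =
      ∑ q : Holonomy Γ, (krawtchouk n p ((n : ℤ) - fixDim (q.out : EucIsom n)) : ℂ) *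
        (xFun s ^ (fixDim (q.out : EucIsom n) - halfCount (q.out : EucIsom n)) *
          yFun s ^ halfCount (q.out : EucIsom n)) := by
  rw [heatTrace, ← tsum_mul_left]
  exact (hasSum_heatTerm hn hΓ p hs).tsum_eq

end Bieb

/-! ### Asymptotics as `s → 0+` and algebraic independence of `x` and `y` -/

namespace Bieb

open Filter Topology

/-- These are the norms of theta terms at `τ = i/π` with an imaginary argument. They serve as the
majorant for dominated convergence when `t ≥ 1`. -/
theorem summable_exp_neg_sq_add (z : ℝ) : Summable fun m : ℤ => Real.exp (-((m : ℝ) ^ 2 + z * m)) := by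
  have hpi : (Real.pi : ℂ) ≠ 0 := by exact_mod_cast Real.pi_ne_zero
  have h := ((summable_jacobiTheta₂_term_iff (z / (2 * Real.pi) * Complex.I)
    ((1 / Real.pi : ℝ) * Complex.I)).2 (by
      have := Real.pi_pos
      simp [this])).norm
  refine h.congr fun m => ?_
  rw [jacobiTheta₂_term, Complex.norm_exp]
  congr 1
  have : 2 * Real.pi * Complex.I * m * (z / (2 * Real.pi) * Complex.I) +
      Real.pi * Complex.I * m ^ 2 * ((1 / Real.pi : ℝ) * Complex.I) =
      ((-((m : ℝ) ^ 2 + z * m) : ℝ) : ℂ) := by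
    push_cast
    field_simp
    rw [Complex.I_sq]
    ring
  rw [this, Complex.ofReal_re]

/-- For an integer-valued quadratic exponent with nonnegative values, the theta series tends to the
number of zeros of the exponent. -/
theorem tendsto_tsum_exp_neg (z : ℝ) (f : ℤ → ℝ) (hf : ∀ m : ℤ, (m : ℝ) ^ 2 + z * m = f m)
    (h0 : ∀ m, 0 ≤ f m) :
    Tendsto (fun t : ℝ => ∑' m : ℤ, Complex.exp (-(t : ℂ) * f m)) atTop
      (𝓝 (∑' m : ℤ, open Classical in if f m = 0 then 1 else 0)) := by
  classical
  refine tendsto_tsum_of_dominated_convergence (summable_exp_neg_sq_add z) (fun m => ?_) ?_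
  · split_ifs with h
    · simp [h]
    · have hpos : 0 < f m := lt_of_le_of_ne (h0 m) (Ne.symm h)
      have h1 : Tendsto (fun t : ℝ => Real.exp (-(t * f m))) atTop (𝓝 0) :=
        Real.tendsto_exp_neg_atTop_nhds_zero.comp (tendsto_id.atTop_mul_const hpos)
      have h2 := (Complex.continuous_ofReal.tendsto 0).comp h1
      rw [Complex.ofReal_zero] at h2
      refine h2.congr fun t => ?_
      simp
  · filter_upwards [eventually_ge_atTop 1] with t ht m
    rw [Complex.norm_exp, hf]
    apply Real.exp_le_exp.2
    have : (-(t : ℂ) * f m).re = -(t * f m) := by simp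
    rw [this]
    nlinarith [h0 m]

theorem tendsto_theta0 : Tendsto (fun t : ℝ => theta0 t) atTop (𝓝 1) := by
  classical
  have h := tendsto_tsum_exp_neg 0 (fun m => (m : ℝ) ^ 2) (fun m => by ring)
    (fun m => sq_nonneg _)
  have h1 : (∑' m : ℤ, if (m : ℝ) ^ 2 = 0 then (1 : ℂ) else 0) = 1 := by
    rw [tsum_eq_single 0]
    · simp
    · intro m hm
      simp [hm]
  have h2 : (fun t : ℝ => theta0 t) =
      fun t : ℝ => ∑' m : ℤ, Complex.exp (-(t : ℂ) * (((m : ℝ) ^ 2 : ℝ) : ℂ)) := by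
    funext t
    unfold theta0
    push_cast
    rfl
  rw [h2, ← h1]
  convert! h

/-- The theta function `θ₁` with its leading exponential factor removed. -/
noncomputable def theta1Red (t : ℝ) : ℂ :=
  ∑' m : ℤ, Complex.exp (-(t : ℂ) * (((m : ℝ) ^ 2 + m : ℝ) : ℂ))

/-- From `(1/2 + m)² = 1/4 + (m² + m)`; the factor pulled out carries the exponential decay of `y`.
-/
theorem theta1_eq (t : ℝ) : theta1 t = Real.exp (-(1 / 4) * t) * theta1Red t := by
  unfold theta1 theta1Red
  rw [← tsum_mul_left]
  congr 1
  funext m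
  rw [Complex.ofReal_exp, ← Complex.exp_add]
  congr 1
  push_cast
  ring

/-- The limit counts the zeros 0 and -1 of `m² + m`. -/
theorem tendsto_theta1Red : Tendsto theta1Red atTop (𝓝 2) := by
  classical
  have hz : ∀ m : ℤ, (m : ℝ) ^ 2 + m = ((m * (m + 1) : ℤ) : ℝ) := fun m => by push_cast; ring
  have h := tendsto_tsum_exp_neg 1 (fun m => (m : ℝ) ^ 2 + m) (fun m => by ring)
    (fun m => by
      rw [hz]
      have : 0 ≤ m * (m + 1) := by
        rcases le_or_gt 0 m with h | h
        · positivity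
        · nlinarith
      exact_mod_cast this)
  have h1 : (∑' m : ℤ, if (m : ℝ) ^ 2 + m = 0 then (1 : ℂ) else 0) = 2 := by
    rw [tsum_eq_sum (s := {0, -1})]
    · rw [Finset.sum_pair (by decide)]
      norm_num
    · intro m hm
      rw [if_neg]
      rw [hz]
      simp only [Finset.mem_insert, Finset.mem_singleton, not_or] at hm
      have : m * (m + 1) ≠ 0 := mul_ne_zero hm.1 (by omega)
      exact_mod_cast this
  rw [← h1]
  convert! h

/-- The substitution `s = 1/(4t)` makes the theta argument `1/(4s)` equal to `t`, so `s → 0+`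
becomes `t → ∞`. -/
theorem sqrt_factor {t : ℝ} (ht : 0 < t) :
    (4 * (Real.pi : ℂ) * ((1 / (4 * t) : ℝ) : ℂ)) ^ (1 / 2 : ℂ) =
      ((Real.sqrt (t / Real.pi))⁻¹ : ℝ) := by
  have h1 : 4 * (Real.pi : ℂ) * ((1 / (4 * t) : ℝ) : ℂ) = ((Real.pi / t : ℝ) : ℂ) := by
    have : (t : ℂ) ≠ 0 := by exact_mod_cast ht.ne'
    push_cast
    field_simp
  have h2 : (1 / 2 : ℂ) = ((1 / 2 : ℝ) : ℂ) := by push_cast; rfl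
  rw [h1, h2, ← Complex.ofReal_cpow (by have := Real.pi_pos; positivity), ← Real.sqrt_eq_rpow,
    ← Real.sqrt_inv, inv_div]

theorem xFun_eq {t : ℝ} (ht : 0 < t) :
    xFun ((1 / (4 * t) : ℝ) : ℂ) = theta0 t * Real.sqrt (t / Real.pi) := by
  have h : 1 / (4 * ((1 / (4 * t) : ℝ) : ℂ)) = t := by
    have : (t : ℂ) ≠ 0 := by exact_mod_cast ht.ne'
    push_cast
    field_simp
  rw [xFun, sqrt_factor ht, h, Complex.ofReal_inv, div_inv_eq_mul]

theorem yFun_eq {t : ℝ} (ht : 0 < t) :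
    yFun ((1 / (4 * t) : ℝ) : ℂ) =
      theta1Red t * ((Real.exp (-(1 / 4) * t) * Real.sqrt (t / Real.pi) : ℝ) : ℂ) := by
  have h : 1 / (4 * ((1 / (4 * t) : ℝ) : ℂ)) = t := by
    have : (t : ℂ) ≠ 0 := by exact_mod_cast ht.ne'
    push_cast
    field_simp
  rw [yFun, sqrt_factor ht, h, Complex.ofReal_inv, div_inv_eq_mul, theta1_eq]
  push_cast
  ring

theorem tendsto_sqrt_pow_mul_exp (a : ℕ) :
    Tendsto (fun t : ℝ => Real.sqrt (t / Real.pi) ^ a * Real.exp (-(1 / 4) * t)) atTop (𝓝 0) := by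
  have h := (tendsto_rpow_mul_exp_neg_mul_atTop_nhds_zero ((a : ℝ) / 2) (1 / 4)
    (by norm_num)).const_mul ((Real.sqrt Real.pi)⁻¹ ^ a)
  rw [mul_zero] at h
  refine h.congr' ?_
  filter_upwards [eventually_gt_atTop 0] with t ht
  rw [Real.sqrt_div ht.le, div_pow, ← mul_assoc]
  congr 1
  rw [inv_pow, Real.sqrt_eq_rpow t, ← Real.rpow_natCast (t ^ (1 / 2 : ℝ)), ← Real.rpow_mul ht.le,
    div_eq_inv_mul, div_eq_inv_mul]
  congr 2
  ring

theorem tendsto_xFun_inv :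
    Tendsto (fun t : ℝ => (xFun ((1 / (4 * t) : ℝ) : ℂ))⁻¹) atTop (𝓝 0) := by
  have h1 : Tendsto (fun t : ℝ => (Real.sqrt (t / Real.pi))⁻¹) atTop (𝓝 0) :=
    tendsto_inv_atTop_zero.comp
      (Real.tendsto_sqrt_atTop.comp (tendsto_id.atTop_div_const Real.pi_pos))
  have h2 := (tendsto_theta0.inv₀ one_ne_zero).mul
    ((Complex.continuous_ofReal.tendsto 0).comp h1)
  rw [Complex.ofReal_zero, mul_zero] at h2
  refine h2.congr' ?_
  filter_upwards [eventually_gt_atTop 0] with t ht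
  rw [xFun_eq ht, mul_inv, Function.comp_apply, Complex.ofReal_inv]

theorem tendsto_xFun_pow_mul_yFun (a : ℕ) :
    Tendsto (fun t : ℝ => xFun ((1 / (4 * t) : ℝ) : ℂ) ^ a * yFun ((1 / (4 * t) : ℝ) : ℂ)) atTop
      (𝓝 0) := by
  have h2 := ((tendsto_theta0.pow a).mul tendsto_theta1Red).mul
    ((Complex.continuous_ofReal.tendsto 0).comp (tendsto_sqrt_pow_mul_exp (a + 1)))
  rw [Complex.ofReal_zero, mul_zero] at h2
  refine h2.congr' ?_
  filter_upwards [eventually_gt_atTop 0] with t ht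
  rw [xFun_eq ht, yFun_eq ht, Function.comp_apply]
  push_cast
  ring

theorem eventually_xFun_ne_zero : ∀ᶠ t : ℝ in atTop, xFun ((1 / (4 * t) : ℝ) : ℂ) ≠ 0 := by
  filter_upwards [eventually_gt_atTop 0, tendsto_theta0.eventually_ne one_ne_zero] with t ht h
  rw [xFun_eq ht]
  refine mul_ne_zero h ?_
  exact_mod_cast (Real.sqrt_pos.2 (div_pos ht Real.pi_pos)).ne'

theorem eventually_yFun_ne_zero : ∀ᶠ t : ℝ in atTop, yFun ((1 / (4 * t) : ℝ) : ℂ) ≠ 0 := by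
  filter_upwards [eventually_gt_atTop 0, tendsto_theta1Red.eventually_ne two_ne_zero] with t ht h
  rw [yFun_eq ht]
  refine mul_ne_zero h ?_
  exact_mod_cast (mul_pos (Real.exp_pos _) (Real.sqrt_pos.2 (div_pos ht Real.pi_pos))).ne'

/-- A criterion for algebraic independence over `ℤ` of two functions, the first of which grows to
infinity while the second decays faster than every power of the first. -/
theorem eq_zero_of_eventually_aeval_eq_zero {α : Type*} {l : Filter α} [l.NeBot] {x y : α → ℂ}
    (hx0 : ∀ᶠ a in l, x a ≠ 0) (hy0 : ∀ᶠ a in l, y a ≠ 0)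
    (hx : Tendsto (fun a => (x a)⁻¹) l (𝓝 0))
    (hxy : ∀ k : ℕ, Tendsto (fun a => x a ^ k * y a) l (𝓝 0))
    {R : MvPolynomial (Fin 2) ℤ} (hR : ∀ᶠ a in l, MvPolynomial.aeval ![x a, y a] R = 0) :
    R = 0 := by
  by_contra hne
  have hsup : R.support.Nonempty := MvPolynomial.support_nonempty.2 hne
  -- The dominant monomial has the lowest power of `y` and, among those, the highest power of `x`.
  -- After division by it every other term tends to 0, so its coefficient would be 0.
  obtain ⟨m₁, hm₁, hmin⟩ := Finset.exists_min_image R.support (fun m => m 1) hsup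
  have hsup' : (R.support.filter fun m => m 1 = m₁ 1).Nonempty := ⟨m₁, by simpa using hm₁⟩
  obtain ⟨m₀, hm₀, hmax⟩ := Finset.exists_max_image _ (fun m => m 0) hsup'
  rw [Finset.mem_filter] at hm₀
  have hy : Tendsto y l (𝓝 0) := by simpa using hxy 0
  classical
  have hterm : ∀ m ∈ R.support, Tendsto (fun a => ((R.coeff m : ℤ) : ℂ) *
      (x a ^ m 0 * (x a)⁻¹ ^ m₀ 0 * y a ^ (m 1 - m₁ 1))) l
      (𝓝 (if m = m₀ then ((R.coeff m : ℤ) : ℂ) else 0)) := by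
    intro m hm
    split_ifs with h
    · have : (fun _ : α => ((R.coeff m : ℤ) : ℂ)) =ᶠ[l] fun a => ((R.coeff m : ℤ) : ℂ) *
          (x a ^ m 0 * (x a)⁻¹ ^ m₀ 0 * y a ^ (m 1 - m₁ 1)) := by
        filter_upwards [hx0] with a ha
        rw [h, hm₀.2, Nat.sub_self, pow_zero, mul_one, ← mul_pow, mul_inv_cancel₀ ha, one_pow,
          mul_one]
      exact tendsto_const_nhds.congr' this
    · rw [← mul_zero ((R.coeff m : ℤ) : ℂ)]
      refine Tendsto.const_mul _ ?_
      rcases (hmin m hm).lt_or_eq with hlt | heq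
      · have h1 := ((hx.pow (m₀ 0)).mul (hxy (m 0))).mul (hy.pow (m 1 - m₁ 1 - 1))
        rw [mul_zero, zero_mul] at h1
        refine h1.congr fun a => ?_
        -- One spare factor `y` absorbs the power `x^(m 0)`.
        have : m 1 - m₁ 1 = (m 1 - m₁ 1 - 1) + 1 := by omega
        conv_rhs => rw [this, pow_succ]
        ring
      · have hle : m 0 ≤ m₀ 0 := hmax m (Finset.mem_filter.2 ⟨hm, heq.symm⟩)
        have hlt : m 0 < m₀ 0 := by
          refine lt_of_le_of_ne hle fun he => h ?_
          ext i
          fin_cases i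
          · exact he
          · exact heq.symm.trans hm₀.2.symm
        have h1 := hx.pow (m₀ 0 - m 0)
        rw [zero_pow (by omega)] at h1
        refine h1.congr' ?_
        filter_upwards [hx0] with a ha
        have h2 : m₀ 0 = (m₀ 0 - m 0) + m 0 := by omega
        conv_rhs => rw [h2, pow_add, ← heq, Nat.sub_self, pow_zero, mul_one]
        rw [mul_comm, mul_assoc, ← mul_pow, inv_mul_cancel₀ ha, one_pow, mul_one]
  have hlim := tendsto_finsetSum _ hterm
  rw [Finset.sum_ite_eq' R.support m₀ (fun m => ((R.coeff m : ℤ) : ℂ)), if_pos hm₀.1] at hlim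
  have hzero : ∀ᶠ a in l, ∑ m ∈ R.support, ((R.coeff m : ℤ) : ℂ) *
      (x a ^ m 0 * (x a)⁻¹ ^ m₀ 0 * y a ^ (m 1 - m₁ 1)) = 0 := by
    filter_upwards [hR, hy0] with a ha hya
    rw [MvPolynomial.aeval_def, MvPolynomial.eval₂_eq'] at ha
    have h1 : ∑ m ∈ R.support, ((R.coeff m : ℤ) : ℂ) *
        (x a ^ m 0 * (x a)⁻¹ ^ m₀ 0 * y a ^ (m 1 - m₁ 1)) * y a ^ m₁ 1 =
        (x a)⁻¹ ^ m₀ 0 * 0 := by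
      rw [← ha, Finset.mul_sum]
      refine Finset.sum_congr rfl fun m hm => ?_
      rw [Fin.prod_univ_two]
      have h2 : m 1 = (m 1 - m₁ 1) + m₁ 1 := (Nat.sub_add_cancel (hmin m hm)).symm
      simp only [Matrix.cons_val_zero, Matrix.cons_val_one]
      conv_rhs => rw [h2, pow_add]
      simp
      ring
    rw [mul_zero, ← Finset.sum_mul] at h1
    exact (mul_eq_zero.1 h1).resolve_right (pow_ne_zero _ hya)
  have h2 := tendsto_nhds_unique (tendsto_const_nhds.congr' (EventuallyEq.symm hzero)) hlim
  have h3 : R.coeff m₀ = 0 := by exact_mod_cast h2.symm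
  exact (MvPolynomial.mem_support_iff.1 hm₀.1) h3

theorem eq_zero_of_aeval_xFun_yFun {R : MvPolynomial (Fin 2) ℤ}
    (hR : ∀ s : ℂ, 0 < s.re → MvPolynomial.aeval ![xFun s, yFun s] R = 0) : R = 0 := by
  refine eq_zero_of_eventually_aeval_eq_zero eventually_xFun_ne_zero eventually_yFun_ne_zero
    tendsto_xFun_inv tendsto_xFun_pow_mul_yFun ?_
  filter_upwards [eventually_gt_atTop 0] with t ht
  exact hR _ (by rw [Complex.ofReal_re]; positivity)

end Bieb

/-! ### The representing polynomial and its coefficients -/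

namespace Bieb

variable {n p : ℕ} {Γ : Subgroup (EucIsom n)}

theorem xyExp_eq_iff (i j k l : ℕ) : xyExp i j = xyExp k l ↔ i = k ∧ j = l := by
  constructor
  · intro h
    have h0 := DFunLike.congr_fun h 0
    have h1 := DFunLike.congr_fun h 1
    simpa [xyExp] using And.intro h0 h1
  · rintro ⟨rfl, rfl⟩
    rfl

/-- The polynomial in `x` and `y` that represents the heat trace. -/
noncomputable def heatPoly (Γ : Subgroup (EucIsom n)) [Fintype (Holonomy Γ)] (p : ℕ) :
    MvPolynomial (Fin 2) ℤ :=
  ∑ q : Holonomy Γ, MvPolynomial.monomial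
    (xyExp (fixDim (q.out : EucIsom n) - halfCount (q.out : EucIsom n))
      (halfCount (q.out : EucIsom n))) (krawtchouk n p ((n : ℤ) - fixDim (q.out : EucIsom n)))

theorem represents_heatPoly (hn : 1 ≤ n) (hΓ : IsDiagInt Γ) [Fintype (Holonomy Γ)] (p : ℕ) :
    Represents Γ p (heatPoly Γ p) := by
  intro s hs
  rw [card_mul_heatTrace hn hΓ p hs, heatPoly, map_sum]
  refine Finset.sum_congr rfl fun q _ => ?_
  rw [MvPolynomial.aeval_monomial, Finsupp.prod_fintype _ _ (by simp), Fin.prod_univ_two]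
  simp [xyExp]

/-- Both invariants are constant on classes, so the chosen representative `q.out` may replace the
existential one. -/
theorem sunada_eq (hΓ : IsDiagInt Γ) [Fintype (Holonomy Γ)] (d t : ℕ) :
    sunada Γ d t = (Finset.univ.filter fun q : Holonomy Γ =>
      fixDim (q.out : EucIsom n) = d ∧ halfCount (q.out : EucIsom n) = t).card := by
  classical
  rw [sunada, Nat.card_eq_fintype_card, Fintype.card_subtype]
  congr 1
  ext q
  simp only [Finset.mem_filter, Finset.mem_univ, true_and]
  constructor
  · rintro ⟨γ, rfl, h1, h2⟩
    have h : ((γ : Holonomy Γ).out : Holonomy Γ) = γ := QuotientGroup.out_eq' _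
    rw [fixDim_congr h, hΓ.halfCount_congr h]
    exact ⟨h1, h2⟩
  · rintro ⟨h1, h2⟩
    exact ⟨q.out, QuotientGroup.out_eq' _, h1, h2⟩

theorem coeff_heatPoly (hΓ : IsDiagInt Γ) [Fintype (Holonomy Γ)] {d t : ℕ} (htd : t ≤ d) :
    (heatPoly Γ p).coeff (xyExp (d - t) t) =
      krawtchouk n p ((n : ℤ) - d) * (sunada Γ d t : ℤ) := by
  classical
  rw [heatPoly, MvPolynomial.coeff_sum, sunada_eq hΓ, Finset.card_filter]
  push_cast
  rw [Finset.mul_sum]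
  refine Finset.sum_congr rfl fun q _ => ?_
  -- This bound and `t ≤ d` keep the natural subtractions exact, so the exponent pair determines
  -- `(d, t)`.
  have hle := hΓ.halfCount_le_fixDim q.out.2
  rw [MvPolynomial.coeff_monomial]
  by_cases h : fixDim (q.out : EucIsom n) = d ∧ halfCount (q.out : EucIsom n) = t
  · rw [if_pos h, h.1, h.2, if_pos rfl, mul_one]
  · rw [if_neg h, if_neg, mul_zero]
    rw [xyExp_eq_iff]
    rintro ⟨h1, h2⟩
    exact h ⟨by omega, h2⟩

theorem exists_sgn_eq_neg_one (hΓ : IsDiagInt Γ) {γ : EucIsom n} (hγ : γ ∈ Γ)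
    (h : fixDim γ ≠ n) : ∃ j, sgn γ j = -1 := by
  by_contra! hcon
  apply h
  rw [hΓ.fixDim_eq hγ, Finset.filter_true_of_mem, Finset.card_univ, Fintype.card_fin]
  exact fun i _ => (sgn_eq γ i).resolve_right (hcon i)

theorem halfCount_pos (hΓ : IsDiagInt Γ) (htf : ∀ γ ∈ Γ, IsOfFinOrder γ → γ = 1) {γ : EucIsom n}
    (hγ : γ ∈ Γ) (h : fixDim γ ≠ n) : 0 < halfCount γ := by
  classical
  obtain ⟨j, hj⟩ := exists_sgn_eq_neg_one hΓ hγ h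
  obtain ⟨i, hi⟩ := hΓ.exists_half htf hγ hj
  rw [halfCount_eq, Finset.card_pos]
  exact ⟨i, by simpa using hi⟩

theorem sunada_zero_right_of_lt (hΓ : IsDiagInt Γ) (htf : ∀ γ ∈ Γ, IsOfFinOrder γ → γ = 1)
    {d : ℕ} (hd : d < n) : sunada Γ d 0 = 0 := by
  have := hΓ.finite_holonomy
  have := Fintype.ofFinite (Holonomy Γ)
  rw [sunada_eq hΓ, Finset.card_eq_zero, Finset.filter_eq_empty_iff]
  rintro q - ⟨h1, h2⟩
  have := halfCount_pos hΓ htf q.out.2 (by omega)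
  omega

theorem linHom_eq_one_of_fixDim_eq (hΓ : IsDiagInt Γ) {γ : EucIsom n} (hγ : γ ∈ Γ)
    (h : fixDim γ = n) : linHom n γ = 1 := by
  have hs : ∀ i, sgn γ i = 1 := by
    rw [hΓ.fixDim_eq hγ] at h
    have h1 : (Finset.univ.filter fun i => sgn γ i = 1) = Finset.univ :=
      Finset.eq_univ_of_card _ (by simpa using h)
    intro i
    have := Finset.mem_univ i
    rw [← h1] at this
    exact (Finset.mem_filter.1 this).2
  ext x i
  rw [hΓ.linHom_apply hγ, hs]
  simp

/-- `n_B = n` forces `B = Id`, which is a single class; its representative 1 has `b = 0` and so no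
half-integer coordinate. -/
theorem sunada_self_zero (hΓ : IsDiagInt Γ) : sunada Γ n 0 = 1 := by
  classical
  have hone : ∀ i, sgn (1 : EucIsom n) i = 1 := fun i => (sgn_eq_one_iff _ i).2 rfl
  have htr : transVec (1 : EucIsom n) = 0 := by
    rw [transVec, AffineIsometryEquiv.coe_one, id, map_zero]
  rw [sunada, Nat.card_eq_one_iff_unique]
  refine ⟨⟨fun q r => Subtype.ext ?_⟩, ⟨⟨((1 : Γ) : Holonomy Γ), 1, rfl, ?_, ?_⟩⟩⟩
  · obtain ⟨_, γ, rfl, hγ, -⟩ := q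
    obtain ⟨_, δ, rfl, hδ, -⟩ := r
    refine (mk_eq_iff γ δ).2 ?_
    rw [linHom_eq_one_of_fixDim_eq hΓ γ.2 hγ, linHom_eq_one_of_fixDim_eq hΓ δ.2 hδ]
  · rw [hΓ.fixDim_eq (1 : Γ).2, OneMemClass.coe_one, Finset.filter_true_of_mem fun i _ => hone i,
      Finset.card_univ, Fintype.card_fin]
  · rw [halfCount_eq, Finset.card_eq_zero, Finset.filter_eq_empty_iff]
    rintro i - ⟨-, m, hm⟩
    rw [OneMemClass.coe_one, htr, PiLp.zero_apply] at hm
    have h2 : (0 : ℤ) = 1 + 2 * m := by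
      have : (0 : ℝ) = 1 + 2 * m := by linarith
      exact_mod_cast this
    omega

theorem krawtchouk_zero (n p : ℕ) : krawtchouk n p 0 = (n.choose p : ℤ) := by
  rw [krawtchouk, Finset.sum_eq_single 0]
  · rw [sub_zero, Ring.choose_natCast]
    simp
  · intro t _ ht
    have : Ring.choose (0 : ℤ) t = 0 := by
      have h := Ring.choose_natCast (R := ℤ) 0 t
      rw [Nat.choose_eq_zero_of_lt (Nat.pos_of_ne_zero ht)] at h
      simpa using h
    rw [this]
    ring
  · simp

theorem coeff_heatPoly_zero_right (hΓ : IsDiagInt Γ) [Fintype (Holonomy Γ)]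
    (htf : ∀ γ ∈ Γ, IsOfFinOrder γ → γ = 1) {k : ℕ} (hk : k < n) :
    (heatPoly Γ p).coeff (xyExp k 0) = 0 := by
  have h := coeff_heatPoly (p := p) hΓ (Nat.zero_le k)
  rw [Nat.sub_zero, sunada_zero_right_of_lt hΓ htf hk] at h
  simpa using h

theorem coeff_heatPoly_top (hΓ : IsDiagInt Γ) [Fintype (Holonomy Γ)] :
    (heatPoly Γ p).coeff (xyExp n 0) = (n.choose p : ℤ) := by
  have h := coeff_heatPoly (p := p) hΓ (Nat.zero_le n)
  rw [Nat.sub_zero, sunada_self_zero hΓ, sub_self, krawtchouk_zero] at h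
  simpa using h

theorem degree_xyExp (i j : ℕ) : ((xyExp i j).sum fun _ e => e) = i + j := by
  rw [Finsupp.sum_fintype _ _ (fun _ => rfl), Fin.sum_univ_two]
  simp [xyExp]

theorem totalDegree_heatPoly (hΓ : IsDiagInt Γ) [Fintype (Holonomy Γ)] (hp : p ≤ n) :
    (heatPoly Γ p).totalDegree = n := by
  apply le_antisymm
  · refine (MvPolynomial.totalDegree_finsetSum _ _).trans (Finset.sup_le fun q _ => ?_)
    refine (MvPolynomial.totalDegree_monomial_le _ _).trans ?_
    have h1 := hΓ.halfCount_le_fixDim q.out.2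
    have h2 := fixDim_le (q.out : EucIsom n)
    have h3 := degree_xyExp (fixDim (q.out : EucIsom n) - halfCount (q.out : EucIsom n))
      (halfCount (q.out : EucIsom n))
    refine h3.le.trans ?_
    omega
  -- The degree `n` is attained at `x^n`, whose coefficient `n.choose p` is nonzero because `p ≤ n`.
  · have h : xyExp n 0 ∈ (heatPoly Γ p).support := by
      rw [MvPolynomial.mem_support_iff, coeff_heatPoly_top hΓ]
      exact_mod_cast (Nat.choose_pos hp).ne'
    have := MvPolynomial.le_totalDegree h
    rwa [degree_xyExp, add_zero] at this

end Bieb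

theorem proposition3p2 (n : ℕ) (hn : 1 ≤ n) (Γ : Subgroup (EucIsom n))
    (hB : Bieb.IsBieberbach Γ) (hdiag : Bieb.IsDiagonalType Γ)
    (hcan : Bieb.translationLattice Γ = Bieb.canonicalLattice n)
    (p : ℕ) (hp : p ≤ n) :
    -- `F` is finite, all eigenvalues have finite multiplicity, and the heat trace converges
    Finite (Bieb.Holonomy Γ) ∧
    (∀ μ : ℝ, FiniteDimensional ℂ (Bieb.eigenforms Γ p μ)) ∧
    (∀ s : ℂ, 0 < s.re → Summable (Bieb.heatTerm Γ p s)) ∧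
    -- `|F| Z_p^Γ` is given by a unique polynomial in `x, y` with integer coefficients
    ∃ P : MvPolynomial (Fin 2) ℤ,
      Bieb.Represents Γ p P ∧ (∀ Q, Bieb.Represents Γ p Q → Q = P) ∧
      P.totalDegree = n ∧
      P.coeff (Bieb.xyExp 0 0) = 0 ∧
      (∀ k : ℕ, 1 ≤ k → k ≤ n - 1 → P.coeff (Bieb.xyExp k 0) = 0) ∧
      P.coeff (Bieb.xyExp n 0) = (n.choose p : ℤ) ∧
      ∀ d t : ℕ, t ≤ d → d ≤ n →
        P.coeff (Bieb.xyExp (d - t) t) =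
          Bieb.krawtchouk n p ((n : ℤ) - d) * (Bieb.sunada Γ d t : ℤ) := by
  have hΓ := hdiag.isDiagInt hcan
  have hfin := hΓ.finite_holonomy
  have := Fintype.ofFinite (Bieb.Holonomy Γ)
  have hrep := Bieb.represents_heatPoly hn hΓ p
  refine ⟨hfin, Bieb.finiteDimensional_eigenforms hn hΓ, fun s hs => Bieb.summable_heatTerm hn hΓ p hs,
    Bieb.heatPoly Γ p, hrep, fun Q hQ => ?_, Bieb.totalDegree_heatPoly hΓ hp,
    Bieb.coeff_heatPoly_zero_right hΓ hB.torsionFree hn,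
    fun k _ hk => Bieb.coeff_heatPoly_zero_right hΓ hB.torsionFree (by omega),
    Bieb.coeff_heatPoly_top hΓ, fun d t htd _ => Bieb.coeff_heatPoly hΓ htd⟩
  -- The difference of two representing polynomials vanishes at `(x(s), y(s))` throughout the half
  -- plane.
  refine sub_eq_zero.1 (Bieb.eq_zero_of_aeval_xFun_yFun fun s hs => ?_)
  rw [map_sub, ← hQ s hs, ← hrep s hs, sub_self]
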